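/- **Theorem 5.1.** Let $E,U$ be complex Hilbert spaces, $0<\alpha<1$, $a>0$, $J=[0,a]$, $X=L^2(J;E)$, and let $A$ be a closed linear operator in $E$ with $A\in\mathcal A^\alpha(\omega_0,\theta_0)$ for some $\omega_0\in\mathbb R$, $\theta_0\in(0,\pi/2]$. That is, $A$ generates an $\alpha$-order solution operator $T_\alpha:[0,\infty)\to\mathcal L(E)$: $T_\alpha$ is strongly continuous, $T_\alpha(0)=I$, and for $x\in D(A)$, $t\ge 0$ one has $T_\alpha(t)x\in D(A)$, $AT_\alpha(t)x=T_\alpha(t)Ax$ and $T_\alpha(t)x=x+\frac1{\Gamma(\alpha)}\int_0^t(t-s)^{\alpha-1}AT_\alpha(s)x\,ds$; moreover $T_\alpha$ extends analytically to $\{z\ne0:|\arg z|<\theta_0\}$, the extension is strongly continuous on $\Sigma_\theta=\{z\neq 0:|\arg z|<\theta\}$ for each $\theta\in(0,\theta_0)$, and for all $\theta\in(0,\theta_0)$ and $\omega>\omega_0$ there is $M>0$ with $\|T_\alpha(z)\|\le Me^{\omega\operatorname{Re}z}$ on $\Sigma_\theta$. Let $S_\alpha:(0,\infty)\to\mathcal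 L(E)$ be the $\alpha$-order resolvent operator generated by $A$: it is strongly continuous and, for some $\omega\ge0$, all $\nu$ with $\operatorname{Re}\nu>\omega$ satisfy $\nu^\alpha\in\rho(A)$ and $(\nu^\alpha I-A)^{-1}x=\int_0^\infty e^{-\nu t}S_\alpha(t)x\,dt$ for $x\in E$. Assume that $T_\alpha(t)$ and $S_\alpha(t)$ are compact for every $t>0$. Let $m\ge 0$ be an integer, let $t_1,\dots,t_m\in J$ and $c_1,\dots,c_m\in\mathbb C$ satisfy $M_T\sum_{k=1}^m|c_k|<1$, where $M_T=\sup_{t\in J}\|T_\alpha(t)\|$; put $\mathcal O=(I-\sum_k c_kT_\alpha(t_k))^{-1}$ and, for $t,s\in J$, $$G(t,s)=\sum_{k=1}^m c_k\mathbf 1_{[0,t_k)}(s)\,T_\alpha(t)\,\mathcal O\,S_\alpha(t_k-s)+\mathbf 1_{[0,t)}(s)\,S_\alpha(t-s).$$ Let $B:L^2(J;U)\to X$ be bounded and linear, with range $R(B)$, and let $f:J\times E\to E$. Consider the problem $$(P)\qquad {}^{C}D^\alpha u(t)=Au(t)+(Bv)(t)+f(t,u(t)),\quad t\in J,\qquad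 u(0)=\sum_{k=1}^m c_ku(t_k),$$ with controls $v\in L^2(J;U)$. For $\mu\in X$, a mild solution with forcing $\mu$ is a function $y\in C(J,E)$ such that, for every $t\in J$, $y(t)=\int_0^aG(t,s)[\mu(s)+f(s,y(s))]\,ds$, the integrand being Bochner integrable; a mild solution of (P) for the control $v$ is a mild solution with forcing $Bv$. Suppose: * (A') Put $Lp=\int_0^aG(a,s)p(s)\,ds$. For every $p\in X$ this Bochner integral exists (which is automatic if $\alpha>1/2$), and there is $q\in\overline{R(B)}$ with $Lp=Lq$ (in particular, this holds if $q$ can be found in $R(B)$). * (B') For every $\mu\in\overline{R(B)}$ there is exactly one mild solution $W\mu$ with forcing $\mu$, and the solution map $W:\overline{R(B)}\to X$ is continuous and compact (it maps bounded sets to relatively compact sets). * (C') The Nemytskii operator $(Fz)(t)=f(t,z(t))$ maps $X$ into $X$, and there is $M\ge 0$ with $\|Fz\|_X\le M$ for all $z\in X$. Then (P) is approximately controllable on $J$: the reachable set $\{y(a): v\in L^2(J;U),\ y \text{ a mild solution of (P) for the control } v\}$ is dense in $E$. -/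

import Mathlib

open MeasureTheory Set

namespace FracControl

noncomputable section

/-- The value `A x` of a partially defined operator, extended by `0` off the domain. -/
def pmapVal {E : Type*} [NormedAddCommGroup E] [InnerProductSpace ℂ E]
    (A : E →ₗ.[ℂ] E) (x : E) : E :=
  open Classical in if h : x ∈ A.domain then A ⟨x, h⟩ else 0

/-- `T` is an `α`-order solution operator generated by `A`; only the values `T t`, `t ≥ 0`,
matter. -/
structure IsSolutionOperator {E : Type*} [NormedAddCommGroup E] [InnerProductSpace ℂ E]
    (α : ℝ) (A : E →ₗ.[ℂ] E) (T : ℝ → E →L[ℂ] E) : Prop where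
  strongly_continuous : ∀ x : E, ContinuousOn (fun t => T t x) (Ici 0)
  map_zero : T 0 = ContinuousLinearMap.id ℂ E
  mapsTo_domain : ∀ t : ℝ, 0 ≤ t → ∀ x ∈ A.domain, T t x ∈ A.domain
  commutes : ∀ t : ℝ, 0 ≤ t → ∀ x ∈ A.domain, pmapVal A (T t x) = T t (pmapVal A x)
  integral_eq : ∀ x ∈ A.domain, ∀ t : ℝ, 0 ≤ t →
    T t x = x + (1 / Real.Gamma α) •
      ∫ s in (0 : ℝ)..t, ((t - s) ^ (α - 1)) • pmapVal A (T s x)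

/-- The open sector `{z ≠ 0 : |arg z| < θ}`. -/
def sector (θ : ℝ) : Set ℂ := {z : ℂ | z ≠ 0 ∧ |z.arg| < θ}

/-- `T` is an analytic `α`-order solution operator generated by `A`, of analyticity type
`(ω₀, θ₀)`. The class of all `A` that admit such a `T` is `𝒜^α(ω₀, θ₀)`. -/
structure IsAnalyticSolutionOperator {E : Type*} [NormedAddCommGroup E] [InnerProductSpace ℂ E]
    (α ω₀ θ₀ : ℝ) (A : E →ₗ.[ℂ] E) (T : ℝ → E →L[ℂ] E) : Prop where
  isSolutionOperator : IsSolutionOperator α A T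
  exists_extension : ∃ Tz : ℂ → E →L[ℂ] E,
    (∀ t : ℝ, 0 < t → Tz (t : ℂ) = T t) ∧
    DifferentiableOn ℂ Tz (sector θ₀) ∧
    (∀ θ : ℝ, 0 < θ → θ < θ₀ → ∀ x : E, ContinuousOn (fun z => Tz z x) (sector θ)) ∧
    (∀ θ : ℝ, 0 < θ → θ < θ₀ → ∀ ω : ℝ, ω₀ < ω → ∃ M : ℝ, 0 < M ∧
      ∀ z ∈ sector θ, ‖Tz z‖ ≤ M * Real.exp (ω * z.re))

/-- `z` lies in the resolvent set of `A` and `R = (z I - A)⁻¹`. -/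
def IsResolventAt {E : Type*} [NormedAddCommGroup E] [InnerProductSpace ℂ E]
    (A : E →ₗ.[ℂ] E) (z : ℂ) (R : E →L[ℂ] E) : Prop :=
  (∀ y : E, R y ∈ A.domain ∧ z • R y - pmapVal A (R y) = y) ∧
  (∀ x ∈ A.domain, R (z • x - pmapVal A x) = x)

/-- `S` is the `α`-order resolvent operator generated by the closed operator `A`. Only the values
`S t`, `t > 0`, matter: for `α < 1` the family behaves like `t ^ (α - 1)` at `t = 0`. -/
structure IsResolventOperator {E : Type*} [NormedAddCommGroup E] [InnerProductSpace ℂ E]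
    (α : ℝ) (A : E →ₗ.[ℂ] E) (S : ℝ → E →L[ℂ] E) : Prop where
  isClosed : A.IsClosed
  strongly_continuous : ∀ x : E, ContinuousOn (fun t => S t x) (Ioi 0)
  laplace : ∃ ω : ℝ, 0 ≤ ω ∧ ∀ ν : ℂ, ω < ν.re →
    ∃ R : E →L[ℂ] E, IsResolventAt A (ν ^ (α : ℂ)) R ∧
      ∀ u : E, IntegrableOn (fun t : ℝ => Complex.exp (-(ν * t)) • S t u) (Ioi 0) ∧
        R u = ∫ t in Ioi (0 : ℝ), Complex.exp (-(ν * t)) • S t u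

/-- A family of operators `(P t)` is compact if `P t` is compact for every `t > 0`. -/
def IsCompactFamily {E : Type*} [NormedAddCommGroup E] [InnerProductSpace ℂ E]
    (P : ℝ → E →L[ℂ] E) : Prop :=
  ∀ t : ℝ, 0 < t → IsCompactOperator (P t)

/-- `M_T`, the supremum of `‖T t‖` over `t ∈ [0, a]`. -/
def supNorm {E : Type*} [NormedAddCommGroup E] [InnerProductSpace ℂ E]
    (a : ℝ) (T : ℝ → E →L[ℂ] E) : ℝ :=
  ⨆ t : Icc (0 : ℝ) a, ‖T t‖

/-- The operator `𝒪 = (I - ∑ₖ cₖ T(tₖ))⁻¹`. -/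
def nonlocalInv {E : Type*} [NormedAddCommGroup E] [InnerProductSpace ℂ E]
    (T : ℝ → E →L[ℂ] E) {m : ℕ} (c : Fin m → ℂ) (τ : Fin m → ℝ) : E →L[ℂ] E :=
  Ring.inverse (1 - ∑ k, c k • T (τ k))

/-- The function of `s ≥ 0` equal to `d` on `[0, r)` and to `0` from `r` on. -/
def chi (r : ℝ) (d : ℂ) (s : ℝ) : ℂ := if s < r then d else 0

/-- The Green function `G(t, s)`, for `t, s ∈ [0, a]`. -/
def green {E : Type*} [NormedAddCommGroup E] [InnerProductSpace ℂ E]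
    (T S : ℝ → E →L[ℂ] E) {m : ℕ} (c : Fin m → ℂ) (τ : Fin m → ℝ) (t s : ℝ) : E →L[ℂ] E :=
  (∑ k, chi (τ k) (c k) s • (T t ∘L nonlocalInv T c τ ∘L S (τ k - s))) + chi t 1 s • S (t - s)

/-- The space `L²([0, a]; E)`. -/
abbrev L2J (a : ℝ) (E : Type*) [NormedAddCommGroup E] : Type _ :=
  Lp E 2 (volume.restrict (Icc (0 : ℝ) a))

/-- `y` is a mild solution on `[0, a]` of `ᶜD^α y = A y + μ + f(·, y)`,
`y(0) = ∑ₖ cₖ y(tₖ)`. -/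
def IsMildSolution {E : Type*} [NormedAddCommGroup E] [InnerProductSpace ℂ E]
    (T S : ℝ → E →L[ℂ] E) {m : ℕ} (c : Fin m → ℂ) (τ : Fin m → ℝ) (a : ℝ)
    (f : ℝ → E → E) (μ : ℝ → E) (y : ℝ → E) : Prop :=
  ContinuousOn y (Icc 0 a) ∧
  ∀ t ∈ Icc (0 : ℝ) a,
    IntegrableOn (fun s => green T S c τ t s (μ s + f s (y s))) (Icc 0 a) ∧
    y t = ∫ s in Icc (0 : ℝ) a, green T S c τ t s (μ s + f s (y s))

/-- The reachable set at time `a`: the values `y(a)` of the mild solutions of the controlled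
equation, over all controls `v ∈ L²([0, a]; U)`. -/
def reachableSet {E U : Type*} [NormedAddCommGroup E] [InnerProductSpace ℂ E]
    [NormedAddCommGroup U] [InnerProductSpace ℂ U]
    (T S : ℝ → E →L[ℂ] E) {m : ℕ} (c : Fin m → ℂ) (τ : Fin m → ℝ) (a : ℝ)
    (f : ℝ → E → E) (B : L2J a U →L[ℂ] L2J a E) : Set E :=
  {x | ∃ (v : L2J a U) (y : ℝ → E), IsMildSolution T S c τ a f (B v) y ∧ x = y a}

/-- Approximate controllability on `[0, a]`: the reachable set is dense. -/
def ApproximatelyControllable {E U : Type*} [NormedAddCommGroup E] [InnerProductSpace ℂ E]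
    [NormedAddCommGroup U] [InnerProductSpace ℂ U]
    (T S : ℝ → E →L[ℂ] E) {m : ℕ} (c : Fin m → ℂ) (τ : Fin m → ℝ) (a : ℝ)
    (f : ℝ → E → E) (B : L2J a U →L[ℂ] L2J a E) : Prop :=
  Dense (reachableSet T S c τ a f B)

/-- The range condition: with `L p = ∫₀ᵃ G(a, s) p(s) ds`, for every `p ∈ L²([0, a]; E)` the
vector `L p` is defined and equals `L q` for some `q` in the closed range of `B`. -/
def RangeCondition {E U : Type*} [NormedAddCommGroup E] [InnerProductSpace ℂ E]
    [NormedAddCommGroup U] [InnerProductSpace ℂ U]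
    (T S : ℝ → E →L[ℂ] E) {m : ℕ} (c : Fin m → ℂ) (τ : Fin m → ℝ) (a : ℝ)
    (B : L2J a U →L[ℂ] L2J a E) : Prop :=
  ∀ p : L2J a E, IntegrableOn (fun s => green T S c τ a s (p s)) (Icc 0 a) ∧
    ∃ q ∈ closure (range B),
      ∫ s in Icc (0 : ℝ) a, green T S c τ a s (p s) =
        ∫ s in Icc (0 : ℝ) a, green T S c τ a s (q s)

/-- `W` is the solution map: for `μ` in the closed range of `B`, there is exactly one mild solution
with forcing `μ`, and `W μ` is its class in `L²([0, a]; E)`. -/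
def IsSolutionMap {E U : Type*} [NormedAddCommGroup E] [InnerProductSpace ℂ E]
    [NormedAddCommGroup U] [InnerProductSpace ℂ U]
    (T S : ℝ → E →L[ℂ] E) {m : ℕ} (c : Fin m → ℂ) (τ : Fin m → ℝ) (a : ℝ)
    (f : ℝ → E → E) (B : L2J a U →L[ℂ] L2J a E)
    (W : closure (range B) → L2J a E) : Prop :=
  ∀ μ : closure (range B), ∃ y : ℝ → E,
    IsMildSolution T S c τ a f (μ : L2J a E) y ∧
    (W μ =ᵐ[volume.restrict (Icc (0 : ℝ) a)] y) ∧
    ∀ y' : ℝ → E, IsMildSolution T S c τ a f (μ : L2J a E) y' → EqOn y' y (Icc 0 a)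

/-- A nonlinear map is compact if it sends bounded sets to relatively compact sets. -/
def IsCompactMap {X Y : Type*} [PseudoMetricSpace X] [TopologicalSpace Y] (W : X → Y) : Prop :=
  ∀ s : Set X, Bornology.IsBounded s → IsCompact (closure (W '' s))

/-- The Nemytskii operator `(F z)(t) = f(t, z(t))` maps `L²([0, a]; E)` into itself and is
uniformly bounded there. -/
def NemytskiiUniformlyBounded {E : Type*} [NormedAddCommGroup E] (a : ℝ) (f : ℝ → E → E) : Prop :=
  ∃ M : ℝ, 0 ≤ M ∧ ∀ z : L2J a E, ∃ w : L2J a E,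
    (w =ᵐ[volume.restrict (Icc (0 : ℝ) a)] fun t => f t (z t)) ∧ ‖w‖ ≤ M

end

end FracControl

/-! Write `K t p = ∫₀ᵃ G(t, s) p(s) ds` and `w z` for the class of `f(·, z(·))`. The mild solution
with forcing `μ` in the closed range of `B` ends at `K a μ + K a (w (W μ))`. The claim is that a
bounded nonlinear perturbation does not destroy the density of the range of `K a`. Four facts carry
this.

Regularity. For `s` close to `a`, `G(a, s) = Q S(a - s)` with `Q` invertible. Integrability of `G(a,
·) p` for every `p` in `L²` therefore passes to `S(a - ·) p`, and the closed graph theorem with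
well-chosen test functions gives `‖S‖ ∈ L²(0, a)` (`lintegral_enorm_sq_lt_top`). Then every `K t` is
bounded and compact, and `t ↦ K t p` is continuous (`exists_greenCLM`).

Density. A functional that vanishes on the range of `K a` kills `Q S(r)` for small `r`. By the
Laplace formula its values on the resolvents `(ξ^α - A)⁻¹`, after composition with `Q`, decay
exponentially in `ξ`, which beats `ξ^α`; so it vanishes on `D(A)`, on the range of `A`, and finally
everywhere (`dense_range_green`).

Continuity. The Nemytskii map is not assumed continuous, but `K t (w (W μ)) = W μ (t) - K t μ` for
almost every `t`, and the right side depends continuously on `μ`. Letting `t` tend to `a` gives weak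
continuity of `μ ↦ K a (w (W μ))`, and compactness of `K a` makes it strong
(`continuous_terminal_term`).

Fixed point. The perturbation takes values in the image of a ball under the compact operator `K a`,
so up to a small error it lies in a finite-dimensional subspace `V` of the range. By the range
condition `V` lifts linearly into the closed range of `B`, and Brouwer's theorem yields a forcing
whose linear part cancels the `V`-component of the perturbation (`exists_dist_add_lt`). Replacing
that forcing by a nearby `B v` finishes the proof. Brouwer's theorem itself comes from a volume
computation with Jacobian determinants. -/

namespace FracControl

/-! ### Volume is preserved by compactly supported perturbations of the identity -/

section Brouwer

open Metric Filter Topology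

variable {V : Type*} [NormedAddCommGroup V] [InnerProductSpace ℝ V] [FiniteDimensional ℝ V]

/-- The determinant of `1 + t A` is recovered at `t = 1` from its values at the interpolation
nodes, since it is a polynomial in `t` of degree at most `dim V`. -/
lemma det_one_add_eq_sum_lagrange {v : ℕ → ℝ} (hv : Function.Injective v) (A : V →L[ℝ] V) :
    (1 + A).det = ∑ i ∈ Finset.range (Module.finrank ℝ V + 1),
      (1 + v i • A).det *
        (Lagrange.basis (Finset.range (Module.finrank ℝ V + 1)) v i).eval 1 := by
  classical
  set b := Module.finBasis ℝ V
  set N := LinearMap.toMatrix b b (A : V →ₗ[ℝ] V)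
  set p : Polynomial ℝ := Matrix.det ((Polynomial.X : Polynomial ℝ) •
    N.map Polynomial.C + (1 : Matrix _ _ ℝ).map Polynomial.C)
  have hdet : ∀ t : ℝ, (1 + t • A).det = p.eval t := by
    intro t
    have h1 : (1 + t • A).det = Matrix.det (t • N + 1) := by
      rw [ContinuousLinearMap.det, ← LinearMap.det_toMatrix b]
      congr 1
      have : ((1 + t • A : V →L[ℝ] V) : V →ₗ[ℝ] V) = t • (A : V →ₗ[ℝ] V) + LinearMap.id := by
        ext x; simp [add_comm]
      rw [this, map_add, map_smul, LinearMap.toMatrix_id]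
    rw [h1, ← Polynomial.coe_evalRingHom, RingHom.map_det]
    congr 1
    ext i j
    simp only [Matrix.add_apply, Matrix.smul_apply, RingHom.mapMatrix_apply, Matrix.map_apply,
      Polynomial.coe_evalRingHom, Polynomial.eval_add, Polynomial.eval_C,
      smul_eq_mul, Polynomial.eval_mul, Polynomial.eval_X]
  have hdeg : p.degree < (Finset.range (Module.finrank ℝ V + 1)).card := by
    rw [Finset.card_range]
    refine lt_of_le_of_lt Polynomial.degree_le_natDegree ?_
    have := Polynomial.natDegree_det_X_add_C_le N (1 : Matrix _ _ ℝ)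
    rw [Fintype.card_fin] at this
    exact_mod_cast Nat.lt_succ_of_le this
  have h := congrArg (Polynomial.eval 1) (Lagrange.eq_interpolate (v := v) hv.injOn hdeg)
  rw [Lagrange.interpolate_apply, Polynomial.eval_finsetSum] at h
  have h1 := hdet 1
  rw [one_smul] at h1
  rw [h1, h]
  refine Finset.sum_congr rfl fun i _ => ?_
  rw [hdet, Polynomial.eval_mul, Polynomial.eval_C]

variable [MeasurableSpace V] [BorelSpace V]

/-- A small compactly supported perturbation of the identity preserves the volume of balls. -/
lemma integral_det_one_add_smul_fderiv {h : V → V} (hh : ContDiff ℝ 1 h) {R : ℝ}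
    (hR : ∀ v, R ≤ ‖v‖ → h v = 0) :
    ∃ t₀ > 0, ∀ t ∈ Icc (0 : ℝ) t₀,
      ∫ v in closedBall (0 : V) R, (1 + t • fderiv ℝ h v).det =
        volume.real (closedBall (0 : V) R) := by
  have hcs : HasCompactSupport h := by
    refine HasCompactSupport.of_support_subset_isCompact (isCompact_closedBall (0 : V) R) ?_
    intro v hv
    rw [mem_closedBall_zero_iff]
    by_contra hcon
    exact hv (hR v (not_le.mp hcon).le)
  obtain ⟨K, hK⟩ := hh.lipschitzWith_of_hasCompactSupport hcs one_ne_zero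
  have hdetpos : ∀ᶠ B : V →L[ℝ] V in 𝓝 0, 0 < (1 + B).det := by
    have hc : Continuous fun B : V →L[ℝ] V => (1 + B).det :=
      ContinuousLinearMap.continuous_det.comp (continuous_const.add continuous_id)
    have : 0 < (1 + (0 : V →L[ℝ] V)).det := by
      rw [add_zero, ContinuousLinearMap.det]; simp
    exact hc.continuousAt.eventually (lt_mem_nhds this)
  obtain ⟨ε, hε, hεdet⟩ := Metric.eventually_nhds_iff.mp hdetpos
  have hK1 : (0 : ℝ) < K + 1 := by positivity
  -- The bound `t * K < 1` makes `v ↦ v + t • h v` bijective, and `t * K < ε` keeps its Jacobian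
  -- positive. Dividing by `K + 1` allows `K = 0`.
  refine ⟨min (ε / 2) (1 / 2) / (K + 1), by positivity, ?_⟩
  rintro t ⟨ht0, ht⟩
  have htK : t * (K + 1) ≤ min (ε / 2) (1 / 2) := (le_div_iff₀ hK1).mp ht
  have htε : t * K < ε := by
    have := htK.trans (min_le_left _ _); nlinarith
  have ht1 : t * K < 1 := by
    have := htK.trans (min_le_right _ _); nlinarith
  set g : V → V := fun v => v + t • h v
  have happ : ApproximatesLinearOn g ((ContinuousLinearEquiv.refl ℝ V : V ≃L[ℝ] V) : V →L[ℝ] V)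
      univ (t.toNNReal * K) := by
    intro x _ y _
    have : g x - g y - ((ContinuousLinearEquiv.refl ℝ V : V ≃L[ℝ] V) : V →L[ℝ] V) (x - y) =
        t • (h x - h y) := by
      simp [g, smul_sub]; abel
    rw [this, norm_smul, Real.norm_of_nonneg ht0, NNReal.coe_mul, Real.coe_toNNReal t ht0, mul_assoc]
    exact mul_le_mul_of_nonneg_left (hK.norm_sub_le x y) ht0
  have hc : Subsingleton V ∨ t.toNNReal * K <
      ‖((ContinuousLinearEquiv.refl ℝ V).symm : V →L[ℝ] V)‖₊⁻¹ := by
    rcases subsingleton_or_nontrivial V with hV | hV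
    · exact Or.inl hV
    · right
      have : ‖((ContinuousLinearEquiv.refl ℝ V).symm : V →L[ℝ] V)‖₊ = 1 :=
        NNReal.coe_injective ContinuousLinearMap.norm_id
      rw [this, inv_one, ← NNReal.coe_lt_coe, NNReal.coe_mul, Real.coe_toNNReal t ht0]
      exact ht1
  have hinj : Function.Injective g := injOn_univ.mp (happ.injOn hc)
  have hsurj : Function.Surjective g := happ.surjective hc
  have hout : ∀ v, R ≤ ‖v‖ → g v = v := fun v hv => by simp [g, hR v hv]
  -- Since `g` fixes every point outside the ball, injectivity prevents a point of the ball from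
  -- leaving it, and surjectivity does the rest.
  have himg : g '' closedBall 0 R = closedBall 0 R := by
    apply Subset.antisymm
    · rintro _ ⟨v, hv, rfl⟩
      by_contra hcon
      rw [mem_closedBall_zero_iff] at hv hcon
      have h1 := hinj (hout (g v) (not_le.mp hcon).le)
      rw [h1] at hcon
      exact hcon hv
    · intro w hw
      obtain ⟨v, rfl⟩ := hsurj w
      refine ⟨v, ?_, rfl⟩
      by_contra hcon
      rw [mem_closedBall_zero_iff] at hcon hw
      rw [hout v (not_le.mp hcon).le] at hw
      exact hcon hw
  have hder : ∀ v, HasFDerivAt g (1 + t • fderiv ℝ h v) v := fun v =>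
    (hasFDerivAt_id v).add (((hh.differentiable one_ne_zero) v).hasFDerivAt.const_smul t)
  have hint := integral_image_eq_integral_abs_det_fderiv_smul volume
    (isClosed_closedBall (x := (0 : V)) (ε := R)).measurableSet
    (fun v _ => (hder v).hasFDerivWithinAt) hinj.injOn (fun _ => (1 : ℝ))
  rw [himg] at hint
  have hpos : ∀ v, 0 < (1 + t • fderiv ℝ h v).det := by
    intro v
    apply hεdet
    rw [dist_zero_right, norm_smul, Real.norm_of_nonneg ht0]
    refine lt_of_le_of_lt ?_ htε
    exact mul_le_mul_of_nonneg_left (norm_fderiv_le_of_lipschitz ℝ hK) ht0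
  simp only [smul_eq_mul, mul_one, integral_const, measureReal_restrict_apply_univ] at hint
  rw [hint]
  exact integral_congr_ae (Eventually.of_forall fun v => (abs_of_pos (hpos v)).symm)

/-- A compactly supported `C¹` perturbation of the identity preserves the oriented volume of
balls. -/
lemma integral_det_fderiv_eq_volume {r : V → V} (hr : ContDiff ℝ 1 r) {R : ℝ}
    (hR : ∀ v, R ≤ ‖v‖ → r v = v) :
    ∫ v in closedBall (0 : V) R, (fderiv ℝ r v).det = volume.real (closedBall (0 : V) R) := by
  set h : V → V := fun v => r v - v
  have hh : ContDiff ℝ 1 h := hr.sub contDiff_id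
  obtain ⟨t₀, ht₀, H⟩ := integral_det_one_add_smul_fderiv hh (R := R)
    fun v hv => by simp [h, hR v hv]
  set d := Module.finrank ℝ V + 1
  -- These distinct nodes lie in `(0, t₀]`, where the volume identity is already known.
  set w : ℕ → ℝ := fun i => t₀ / (i + 1)
  have hw : Function.Injective w := by
    intro i j hij
    have h1 : t₀ / ((i : ℝ) + 1) = t₀ / ((j : ℝ) + 1) := hij
    have hi : (0 : ℝ) < (i : ℝ) + 1 := by positivity
    have hj : (0 : ℝ) < (j : ℝ) + 1 := by positivity
    rw [div_eq_div_iff hi.ne' hj.ne'] at h1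
    have h2 := mul_left_cancel₀ ht₀.ne' h1
    have h3 : (i : ℝ) = j := by linarith
    exact_mod_cast h3
  have hwmem : ∀ i, w i ∈ Icc 0 t₀ := fun i =>
    ⟨by positivity, div_le_self ht₀.le (by have : (0 : ℝ) ≤ i := by positivity
                                           linarith)⟩
  have hfd : ∀ v, fderiv ℝ r v = 1 + fderiv ℝ h v := by
    intro v
    have : fderiv ℝ h v = fderiv ℝ r v - 1 :=
      (((hr.differentiable one_ne_zero) v).hasFDerivAt.sub (hasFDerivAt_id v)).fderiv
    rw [this]; abel
  have hcont : ∀ t : ℝ, Continuous fun v => (1 + t • fderiv ℝ h v).det := fun t =>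
    ContinuousLinearMap.continuous_det.comp
      (continuous_const.add ((hh.continuous_fderiv one_ne_zero).const_smul t))
  have hint : ∀ t : ℝ, IntegrableOn (fun v => (1 + t • fderiv ℝ h v).det) (closedBall (0 : V) R) :=
    fun t => (hcont t).continuousOn.integrableOn_compact (isCompact_closedBall _ _)
  -- The integral of `(1 + t • fderiv ℝ h v).det` is a polynomial in `t` with the same value at all
  -- nodes. As the Lagrange basis sums to `1`, that is also its value at `t = 1`.
  rw [funext fun v => (congrArg ContinuousLinearMap.det (hfd v)).trans
    (det_one_add_eq_sum_lagrange hw (fderiv ℝ h v))]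
  rw [integral_finsetSum _ fun i _ => (hint (w i)).mul_const _]
  simp_rw [integral_mul_const, H _ (hwmem _)]
  rw [← Finset.mul_sum, ← Polynomial.eval_finsetSum,
    Lagrange.sum_basis hw.injOn (Finset.nonempty_range_iff.mpr (Nat.succ_ne_zero _)),
    Polynomial.eval_one, mul_one]

end Brouwer
-- Brouwer's fixed point theorem
section Brouwer

open Metric Filter Topology

variable {V : Type*} [NormedAddCommGroup V] [InnerProductSpace ℝ V]

/-- The radial profile equal to `R` up to `R` and to the identity from `R + 1` on. -/
noncomputable def radialProfile (R s : ℝ) : ℝ := R + (s - R) * Real.smoothTransition (s - R)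

lemma radialProfile_of_le {R s : ℝ} (h : s ≤ R) : radialProfile R s = R := by
  rw [radialProfile, Real.smoothTransition.zero_of_nonpos (by linarith), mul_zero, add_zero]

lemma radialProfile_of_ge {R s : ℝ} (h : R + 1 ≤ s) : radialProfile R s = s := by
  rw [radialProfile, Real.smoothTransition.one_of_one_le (by linarith)]; ring

lemma le_radialProfile (R s : ℝ) : R ≤ radialProfile R s := by
  rcases le_total s R with h | h
  · exact (radialProfile_of_le h).ge
  · have := mul_nonneg (sub_nonneg.mpr h) (Real.smoothTransition.nonneg (s - R))
    rw [radialProfile]; linarith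

lemma lt_radialProfile {R s : ℝ} (h : R < s) : R < radialProfile R s := by
  have := mul_pos (sub_pos.mpr h) (Real.smoothTransition.pos_of_pos (sub_pos.mpr h))
  rw [radialProfile]; linarith

lemma radialProfile_le {R s : ℝ} (h : R ≤ s) : radialProfile R s ≤ s := by
  have := mul_le_mul_of_nonneg_left (Real.smoothTransition.le_one (s - R)) (sub_nonneg.mpr h)
  rw [radialProfile]; linarith

lemma radialProfile_strictMonoOn (R : ℝ) : StrictMonoOn (radialProfile R) (Ioi R) := by
  intro s hs t _ hst
  have hs' : R < s := hs
  have h1 : (s - R) * Real.smoothTransition (s - R) < (t - R) * Real.smoothTransition (s - R) :=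
    mul_lt_mul_of_pos_right (by linarith) (Real.smoothTransition.pos_of_pos (sub_pos.mpr hs'))
  have h2 : (t - R) * Real.smoothTransition (s - R) ≤ (t - R) * Real.smoothTransition (t - R) :=
    mul_le_mul_of_nonneg_left (Real.smoothTransition.monotone (by linarith)) (by linarith)
  rw [radialProfile, radialProfile]; linarith

/-- The radial map which collapses the punctured ball of radius `R` onto its sphere. -/
noncomputable def radialCollapse (R : ℝ) (w : V) : V := (radialProfile R ‖w‖ / ‖w‖) • w

lemma norm_radialCollapse {R : ℝ} (hR : 0 ≤ R) {w : V} (hw : w ≠ 0) :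
    ‖radialCollapse R w‖ = radialProfile R ‖w‖ := by
  have h : 0 < ‖w‖ := norm_pos_iff.mpr hw
  rw [radialCollapse, norm_smul, Real.norm_of_nonneg
    (div_nonneg (hR.trans (le_radialProfile R _)) h.le), div_mul_cancel₀ _ h.ne']

lemma radialCollapse_of_ge {R : ℝ} (hR : 0 ≤ R) {w : V} (hw : R + 1 ≤ ‖w‖) :
    radialCollapse R w = w := by
  rw [radialCollapse, radialProfile_of_ge hw, div_self (by linarith), one_smul]

lemma contDiffAt_radialCollapse (R : ℝ) {w : V} (hw : w ≠ 0) :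
    ContDiffAt ℝ 1 (radialCollapse R : V → V) w := by
  have hn : ContDiffAt ℝ 1 (fun w : V => ‖w‖) w := contDiffAt_norm ℝ hw
  have hp : ContDiff ℝ 1 (radialProfile R) :=
    contDiff_const.add ((contDiff_id.sub contDiff_const).mul
      ((Real.smoothTransition.contDiff (n := 1)).comp (contDiff_id.sub contDiff_const)))
  exact ((hp.contDiffAt.comp w hn).div hn (norm_ne_zero_iff.mpr hw)).smul contDiffAt_id

lemma injOn_radialCollapse {R : ℝ} (hR : 0 ≤ R) :
    InjOn (radialCollapse R : V → V) {w | R < ‖w‖} := by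
  intro w hw w' hw' h
  have hw0 : 0 < ‖w‖ := lt_of_le_of_lt hR hw
  have hw0' : 0 < ‖w'‖ := lt_of_le_of_lt hR hw'
  have hn : ‖w‖ = ‖w'‖ := by
    refine (radialProfile_strictMonoOn R).injOn hw hw' ?_
    rw [← norm_radialCollapse hR (norm_pos_iff.mp hw0),
      ← norm_radialCollapse hR (norm_pos_iff.mp hw0'), h]
  rw [radialCollapse, radialCollapse, hn] at h
  refine smul_right_injective V (div_pos ?_ hw0').ne' h
  exact lt_of_le_of_lt hR (lt_radialProfile hw')

variable [FiniteDimensional ℝ V]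

/-- The derivative of a map of locally constant nonzero norm is singular. -/
lemma det_fderiv_eq_zero_of_norm_eventually_const {r : V → V} {v : V} {R : ℝ} (hR : 0 < R)
    (hd : DifferentiableAt ℝ r v) (h : ∀ᶠ w in 𝓝 v, ‖r w‖ = R) : (fderiv ℝ r v).det = 0 := by
  have horth : ∀ x, inner ℝ (r v) (fderiv ℝ r v x) = 0 := by
    intro x
    have h1 := (hd.hasFDerivAt.norm_sq)
    have h2 : HasFDerivAt (fun w => ‖r w‖ ^ 2) (0 : V →L[ℝ] ℝ) v :=
      (hasFDerivAt_const (R ^ 2) v).congr_of_eventuallyEq (h.mono fun w hw => by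
        show ‖r w‖ ^ 2 = R ^ 2
        rw [hw])
    have h3 := congrArg (fun f : V →L[ℝ] ℝ => f x) (h1.unique h2)
    simpa using h3
  -- An invertible derivative would attain the value `r v`, which is orthogonal to its whole image,
  -- forcing `r v = 0` against `‖r v‖ = R > 0`.
  by_contra hne
  have hu : IsUnit ((fderiv ℝ r v : V →L[ℝ] V) : V →ₗ[ℝ] V) :=
    (LinearMap.isUnit_iff_isUnit_det _).mpr (isUnit_iff_ne_zero.mpr hne)
  obtain ⟨x, hx⟩ := ((Module.End.isUnit_iff _).mp hu).2 (r v)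
  have h0 := horth x
  rw [show fderiv ℝ r v x = r v from hx, inner_self_eq_zero] at h0
  have hR' := h.self_of_nhds
  rw [h0, norm_zero] at hR'
  exact hR.ne hR'

/-- A `C¹` map of a Euclidean space with compact support has a fixed point. -/
lemma exists_fixedPoint_of_contDiff {Ψ : V → V} (hΨ : ContDiff ℝ 1 Ψ) {R : ℝ}
    (hR : ∀ v, R ≤ ‖v‖ → Ψ v = 0) {C : ℝ} (hC : ∀ v, ‖Ψ v‖ ≤ C) : ∃ v, Ψ v = v := by
  by_contra! hne
  let _ : MeasurableSpace V := borel V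
  have _ : BorelSpace V := ⟨rfl⟩
  have hC0 : 0 ≤ C := (norm_nonneg _).trans (hC 0)
  have hR0 : 0 < R := by
    by_contra hcon
    exact hne 0 (hR 0 (by rw [norm_zero]; exact not_lt.mp hcon))
  -- With this radius `v ↦ v - Ψ v` maps the ball of radius `R₀` into itself.
  set R₀ := R + C
  have hR₀ : 0 < R₀ := by positivity
  set g : V → V := fun v => v - Ψ v
  have hg0 : ∀ v, g v ≠ 0 := fun v hv => hne v (sub_eq_zero.mp hv).symm
  have hgout : ∀ v, R ≤ ‖v‖ → g v = v := fun v hv => by simp [g, hR v hv]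
  have hgin : ∀ v, ‖v‖ ≤ R₀ → ‖g v‖ ≤ R₀ := by
    intro v hv
    rcases le_total R ‖v‖ with h | h
    · rwa [hgout v h]
    · exact (norm_sub_le _ _).trans (add_le_add h (hC v))
  have hRR₀ : R ≤ R₀ := le_add_of_nonneg_right hC0
  -- Without fixed points `v - Ψ v` avoids the origin, the only point where the radial collapse is
  -- not smooth. So `r` is `C¹`, sends the ball of radius `R₀` to its sphere and is the identity
  -- from `R₀ + 1` on.
  set r : V → V := fun v => radialCollapse R₀ (g v)
  have hr : ContDiff ℝ 1 r := by
    rw [contDiff_iff_contDiffAt]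
    intro v
    exact (contDiffAt_radialCollapse R₀ (hg0 v)).comp v (contDiff_id.sub hΨ).contDiffAt
  have hrd := hr.differentiable one_ne_zero
  have hrout : ∀ v, R₀ + 1 ≤ ‖v‖ → r v = v := by
    intro v hv
    show radialCollapse R₀ (g v) = v
    rw [hgout v (by linarith), radialCollapse_of_ge hR₀.le hv]
  have hrk : ∀ v, R₀ ≤ ‖v‖ → r v = radialCollapse R₀ v := by
    intro v hv
    show radialCollapse R₀ (g v) = _
    rw [hgout v (by linarith)]
  have hdetc : Continuous fun v => (fderiv ℝ r v).det :=
    ContinuousLinearMap.continuous_det.comp (hr.continuous_fderiv one_ne_zero)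
  have hdet0 : ∀ v ∈ closedBall (0 : V) R₀, (fderiv ℝ r v).det = 0 := by
    have hcl : IsClosed {v | (fderiv ℝ r v).det = 0} := isClosed_eq hdetc continuous_const
    rw [← closure_ball (0 : V) hR₀.ne']
    refine closure_minimal ?_ hcl
    intro v hv
    refine det_fderiv_eq_zero_of_norm_eventually_const hR₀ (hrd v) ?_
    filter_upwards [isOpen_ball.mem_nhds hv] with w hw
    rw [norm_radialCollapse hR₀.le (hg0 w)]
    exact radialProfile_of_le (hgin w (mem_ball_zero_iff.mp hw).le)
  set K := closedBall (0 : V) (R₀ + 1)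
  have hKm : MeasurableSet (closedBall (0 : V) R₀) := isClosed_closedBall.measurableSet
  set Ann := K \ closedBall (0 : V) R₀
  have hAnn : MeasurableSet Ann := isClosed_closedBall.measurableSet.diff hKm
  have hAnn' : ∀ v ∈ Ann, R₀ < ‖v‖ := fun v hv => by
    have := hv.2
    rwa [mem_closedBall_zero_iff, not_le] at this
  have hsub : closedBall (0 : V) R₀ ⊆ K := closedBall_subset_closedBall (by linarith)
  have hvol := integral_det_fderiv_eq_volume hr hrout
  have hint : IntegrableOn (fun v => (fderiv ℝ r v).det) K :=
    hdetc.continuousOn.integrableOn_compact (isCompact_closedBall _ _)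
  have hsplit : ∫ v in K, (fderiv ℝ r v).det = ∫ v in Ann, (fderiv ℝ r v).det := by
    have h1 := setIntegral_sdiff hKm hint hsub
    rw [setIntegral_eq_zero_of_forall_eq_zero hdet0, sub_zero] at h1
    exact h1.symm
  have hrinj : InjOn r Ann := by
    intro v hv w hw h
    rw [hrk v (hAnn' v hv).le, hrk w (hAnn' w hw).le] at h
    exact injOn_radialCollapse hR₀.le (hAnn' v hv) (hAnn' w hw) h
  have hcov := integral_image_eq_integral_abs_det_fderiv_smul volume hAnn
    (fun v _ => (hrd v).hasFDerivAt.hasFDerivWithinAt) hrinj (fun _ => (1 : ℝ))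
  simp only [smul_eq_mul, mul_one, integral_const, measureReal_restrict_apply_univ] at hcov
  have himg : r '' Ann ⊆ Ann := by
    rintro _ ⟨v, hv, rfl⟩
    have hv' := hAnn' v hv
    have hv0 : v ≠ 0 := norm_pos_iff.mp (hR₀.trans hv')
    have hvK := mem_closedBall_zero_iff.mp hv.1
    rw [hrk v hv'.le]
    refine ⟨?_, ?_⟩
    · rw [mem_closedBall_zero_iff, norm_radialCollapse hR₀.le hv0]
      exact (radialProfile_le hv'.le).trans hvK
    · rw [mem_closedBall_zero_iff, not_le, norm_radialCollapse hR₀.le hv0]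
      exact lt_radialProfile hv'
  have hKfin : volume K ≠ ⊤ := (isCompact_closedBall (0 : V) _).measure_lt_top.ne
  -- The inner ball contributes nothing to the integral of the Jacobian, so the volume of `K` is at
  -- most that of `r '' Ann`, hence of `Ann`. But `Ann` misses a ball of positive volume.
  have hle : volume.real K ≤ volume.real Ann := by
    calc volume.real K = ∫ v in Ann, (fderiv ℝ r v).det := by rw [← hsplit, hvol]
      _ ≤ ∫ v in Ann, |(fderiv ℝ r v).det| :=
        integral_mono (hint.mono_set sdiff_subset) (hint.mono_set sdiff_subset).abs
          fun v => le_abs_self _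
      _ = volume.real (r '' Ann) := hcov.symm
      _ ≤ volume.real Ann :=
        measureReal_mono himg (ne_top_of_le_ne_top hKfin (measure_mono sdiff_subset))
  have hdiff : volume.real Ann = volume.real K - volume.real (closedBall (0 : V) R₀) :=
    measureReal_sdiff hsub hKm
  have hpos : 0 < volume.real (closedBall (0 : V) R₀) :=
    ENNReal.toReal_pos (measure_closedBall_pos volume (0 : V) hR₀).ne'
      (isCompact_closedBall (0 : V) _).measure_lt_top.ne
  linarith

/-- A bounded continuous self-map of a Euclidean space has a fixed point. -/
lemma exists_fixedPoint_of_bounded_euclidean {Ψ : V → V} (hΨ : Continuous Ψ) {C : ℝ}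
    (hC : ∀ v, ‖Ψ v‖ ≤ C) : ∃ v, Ψ v = v := by
  by_contra! hne
  have hC0 : 0 ≤ C := (norm_nonneg _).trans (hC 0)
  -- This cutoff is `1` up to radius `C + 1` and `0` from `C + 2` on. Fixed points of `χ • Ψ` have
  -- norm at most `C`, so they are fixed points of `Ψ`.
  set χ : V → ℝ := fun v => max 0 (min 1 (C + 2 - ‖v‖))
  have hχ0 : ∀ v, 0 ≤ χ v := fun v => le_max_left _ _
  have hχ1 : ∀ v, χ v ≤ 1 := fun v => max_le zero_le_one (min_le_left _ _)
  have hχc : Continuous χ := by fun_prop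
  set Ψ₁ : V → V := fun v => χ v • Ψ v
  have hΨ₁c : Continuous Ψ₁ := hχc.smul hΨ
  have hΨ₁b : ∀ v, ‖Ψ₁ v‖ ≤ C := by
    intro v
    rw [norm_smul, Real.norm_of_nonneg (hχ0 v)]
    exact (mul_le_of_le_one_left (norm_nonneg _) (hχ1 v)).trans (hC v)
  have hΨ₁0 : ∀ v, C + 2 ≤ ‖v‖ → Ψ₁ v = 0 := by
    intro v hv
    have : χ v = 0 := max_eq_left ((min_le_right _ _).trans (by linarith))
    show χ v • Ψ v = 0
    rw [this, zero_smul]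
  have hne₁ : ∀ v, Ψ₁ v ≠ v := by
    intro v hv
    have hvC : ‖v‖ ≤ C := by rw [← hv]; exact hΨ₁b v
    have : χ v = 1 := by
      show max 0 (min 1 (C + 2 - ‖v‖)) = 1
      rw [min_eq_left (by linarith), max_eq_right zero_le_one]
    apply hne v
    rw [← hv]
    show Ψ _ = χ v • Ψ v
    rw [hv, this, one_smul]
  have hcont : Continuous fun v => ‖v - Ψ₁ v‖ := (continuous_id.sub hΨ₁c).norm
  obtain ⟨v₀, -, hv₀⟩ := (isCompact_closedBall (0 : V) (C + 2)).exists_isMinOn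
    ⟨0, mem_closedBall_self (by linarith)⟩ hcont.continuousOn
  -- The minimum displacement over the ball of radius `C + 2`. Outside it `Ψ₁ = 0` and the
  -- displacement is at least `2`, whence the cap at `1`.
  set ε := min ‖v₀ - Ψ₁ v₀‖ 1
  have hε : 0 < ε :=
    lt_min (norm_pos_iff.mpr (sub_ne_zero.mpr (hne₁ v₀).symm)) one_pos
  have hlow : ∀ v, ε ≤ ‖v - Ψ₁ v‖ := by
    intro v
    rcases le_total ‖v‖ (C + 2) with h | h
    · exact (min_le_left _ _).trans (hv₀ (mem_closedBall_zero_iff.mpr h))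
    · rw [hΨ₁0 v h, sub_zero]
      exact (min_le_right _ _).trans (by linarith)
  obtain ⟨Ψ₂, hsm, happ, hsupp⟩ := hΨ₁c.exists_contDiff_approx 1
    (continuous_const (y := ε)) (fun _ => hε)
  have h0 : ∀ v, C + 2 ≤ ‖v‖ → Ψ₂ v = 0 := by
    intro v hv
    by_contra hcon
    exact hsupp hcon (hΨ₁0 v hv)
  have hb : ∀ v, ‖Ψ₂ v‖ ≤ C + ε := by
    intro v
    have h1 := norm_le_norm_add_norm_sub (Ψ₁ v) (Ψ₂ v)
    have h2 := happ v
    rw [dist_eq_norm, norm_sub_rev] at h2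
    linarith [hΨ₁b v]
  obtain ⟨v, hv⟩ := exists_fixedPoint_of_contDiff (by exact_mod_cast hsm) h0 hb
  have h1 := happ v
  rw [dist_eq_norm, hv] at h1
  exact (hlow v).not_gt h1

end Brouwer

/-- **Brouwer's theorem**: a bounded continuous self-map of a finite-dimensional real normed space
has a fixed point. -/
theorem exists_fixedPoint_of_bounded {F : Type*} [NormedAddCommGroup F] [NormedSpace ℝ F]
    [FiniteDimensional ℝ F] {Ψ : F → F} (hΨ : Continuous Ψ) {C : ℝ} (hC : ∀ v, ‖Ψ v‖ ≤ C) :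
    ∃ v, Ψ v = v := by
  let e := toEuclidean (E := F)
  obtain ⟨v, hv⟩ := exists_fixedPoint_of_bounded_euclidean (Ψ := fun v => e (Ψ (e.symm v)))
    (e.continuous.comp (hΨ.comp e.symm.continuous)) 
    (C := ‖e.toContinuousLinearMap‖ * C)
    fun v => (e.toContinuousLinearMap.le_opNorm (Ψ (e.symm v))).trans
      (mul_le_mul_of_nonneg_left (hC _) (norm_nonneg _))
  exact ⟨e.symm v, e.injective (hv.trans (e.apply_symm_apply v).symm)⟩

/-! ### Measurability and square integrability of operator families -/

section Families

open Filter Topology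

variable {E F : Type*} [NormedAddCommGroup E] [InnerProductSpace ℂ E]
  [NormedAddCommGroup F] [InnerProductSpace ℂ F]

/-- The family of operators extended by `0` to `r ≤ 0`. -/
noncomputable def causal (R : ℝ → E →L[ℂ] F) (r : ℝ) : E →L[ℂ] F := if 0 < r then R r else 0

lemma causal_of_pos (R : ℝ → E →L[ℂ] F) {r : ℝ} (hr : 0 < r) : causal R r = R r := if_pos hr

lemma causal_of_nonpos (R : ℝ → E →L[ℂ] F) {r : ℝ} (hr : r ≤ 0) : causal R r = 0 :=
  if_neg hr.not_gt

/-- Absorbing the indicator into the extension by zero turns each term of the Green function into a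
convolution kernel. -/
lemma chi_smul_apply (R : ℝ → E →L[ℂ] F) (d : ℂ) (t s : ℝ) :
    chi t d s • R (t - s) = d • causal R (t - s) := by
  by_cases h : s < t
  · rw [causal_of_pos R (sub_pos.mpr h), chi, if_pos h]
  · rw [causal_of_nonpos R (sub_nonpos.mpr (not_lt.mp h)), chi, if_neg h, zero_smul, smul_zero]

lemma stronglyMeasurable_causal {R : ℝ → E →L[ℂ] F}
    (hR : ∀ x, ContinuousOn (fun r => R r x) (Ioi 0)) (x : E) :
    StronglyMeasurable fun r => causal R r x := by
  refine stronglyMeasurable_of_stronglyMeasurable_union_cover (Ioi 0) (Iic 0) measurableSet_Ioi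
    measurableSet_Iic (fun r _ => (lt_or_ge 0 r).imp id id) ?_ ?_
  · have : (fun r : Ioi (0 : ℝ) => causal R r x) = fun r : Ioi (0 : ℝ) => R r x :=
      funext fun r => by rw [causal_of_pos R r.2]
    rw [this]
    exact (continuousOn_iff_continuous_domRestrict.mp (hR x)).stronglyMeasurable
  · have : (fun r : Iic (0 : ℝ) => causal R r x) = fun _ => 0 :=
      funext fun r => by rw [causal_of_nonpos R r.2]; rfl
    rw [this]
    exact stronglyMeasurable_const

/-- The norm of a strongly continuous family is computed on countably many vectors. -/
lemma exists_norming_seq {R : ℝ → E →L[ℂ] F}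
    (hR : ∀ x, ContinuousOn (fun r => R r x) (Ioi 0)) :
    ∃ x : ℕ → E, (∀ n, ‖x n‖ ≤ 1) ∧
      ∀ r, ∀ q < ‖causal R r‖, ∃ n, q < ‖causal R r (x n)‖ := by
  let B := Metric.closedBall (0 : E) 1
  have hopen : ∀ (q : ℚ) (x : B), IsOpen {r : ℝ | 0 < r ∧ (q : ℝ) < ‖R r x‖} := fun q x =>
    (hR x).norm.isOpen_inter_preimage isOpen_Ioi isOpen_Ioi
  -- Lindelöf in `ℝ`: for each rational `q`, countably many vectors suffice for the union of these
  -- open sets. Separability of `E` is not needed.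
  choose T hTc hT using fun q : ℚ => TopologicalSpace.isOpen_iUnion_countable _ (hopen q)
  have hcount : (insert (⟨0, Metric.mem_closedBall_self zero_le_one⟩ : B) (⋃ q, T q)).Countable :=
    (countable_iUnion hTc).insert _
  obtain ⟨x, hx⟩ := hcount.exists_eq_range (insert_nonempty _ _)
  refine ⟨fun n => x n, fun n => mem_closedBall_zero_iff.mp (x n).2, fun r q hq => ?_⟩
  rcases lt_or_ge 0 r with hr | hr
  · rw [causal_of_pos R hr] at hq ⊢
    obtain ⟨q', hqq', hq'⟩ := exists_rat_btwn hq
    obtain ⟨y, hy, hyq⟩ := ContinuousLinearMap.exists_lt_apply_of_lt_opNorm (R r) hq'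
    have hmem : r ∈ ⋃ x : B, {r : ℝ | 0 < r ∧ (q' : ℝ) < ‖R r x‖} :=
      mem_iUnion.mpr ⟨⟨y, mem_closedBall_zero_iff.mpr hy.le⟩, hr, hyq⟩
    rw [← hT q'] at hmem
    obtain ⟨z, hzT, hz⟩ := mem_iUnion₂.mp hmem
    have : z ∈ range x := hx ▸ mem_insert_of_mem _ (mem_iUnion.mpr ⟨q', hzT⟩)
    obtain ⟨n, rfl⟩ := this
    exact ⟨n, hqq'.trans hz.2⟩
  · rw [causal_of_nonpos R hr, norm_zero] at hq
    exact ⟨0, hq.trans_le (norm_nonneg _)⟩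

lemma measurable_norm_causal {R : ℝ → E →L[ℂ] F}
    (hR : ∀ x, ContinuousOn (fun r => R r x) (Ioi 0)) : Measurable fun r => ‖causal R r‖ := by
  obtain ⟨x, hx1, hx⟩ := exists_norming_seq hR
  refine measurable_of_Ioi fun q => ?_
  have : (fun r => ‖causal R r‖) ⁻¹' Ioi q = ⋃ n, {r | q < ‖causal R r (x n)‖} := by
    ext r
    refine ⟨fun h => mem_iUnion.mpr (hx r q h), fun h => ?_⟩
    obtain ⟨n, hn⟩ := mem_iUnion.mp h
    exact lt_of_lt_of_le hn ((causal R r).unit_le_opNorm _ (hx1 n))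
  rw [this]
  exact MeasurableSet.iUnion fun n => measurableSet_lt measurable_const
    (stronglyMeasurable_causal hR (x n)).norm.measurable

variable {Ω : Type*} [MeasurableSpace Ω] {ν : Measure Ω}

/-- A strongly measurable family of operators acts on measurable functions. -/
lemma aestronglyMeasurable_apply {H : Ω → E →L[ℂ] F} (hH : ∀ x, StronglyMeasurable fun s => H s x)
    {p : Ω → E} (hp : AEStronglyMeasurable p ν) : AEStronglyMeasurable (fun s => H s (p s)) ν := by
  obtain ⟨p', hp', hpp'⟩ := hp
  have hsimple : ∀ f : SimpleFunc Ω E, StronglyMeasurable fun s => H s (f s) := by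
    intro f
    induction f using SimpleFunc.induction with
    | @const c s hs =>
      have : (fun ω => H ω ((SimpleFunc.piecewise s hs (SimpleFunc.const Ω c)
          (SimpleFunc.const Ω 0)) ω)) = s.indicator fun ω => H ω c := by
        ext ω
        by_cases h : ω ∈ s <;> simp [h]
      rw [this]
      exact (hH c).indicator hs
    | @add f g _ hf hg =>
      simp only [SimpleFunc.coe_add, Pi.add_apply, map_add]
      exact hf.add hg
  refine ⟨fun s => H s (p' s), ?_, hpp'.mono fun s hs => congrArg (H s) hs⟩
  refine stronglyMeasurable_of_tendsto atTop (fun n => hsimple (hp'.approx n)) ?_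
  rw [tendsto_pi_nhds]
  exact fun s => ((H s).continuous.tendsto _).comp (hp'.tendsto_approx s)

/-- Finitely many vectors admit a simple selection that nearly norms the operators. -/
lemma exists_simple_selection {H : Ω → E →L[ℂ] F} (hH : ∀ x, StronglyMeasurable fun s => H s x)
    {x : ℕ → E} (hx : ∀ n, ‖x n‖ ≤ 1) (n : ℕ) :
    ∃ σ : SimpleFunc Ω E, (∀ s, ‖σ s‖ ≤ 1) ∧ ∀ s, ∀ i ≤ n, ‖H s (x i)‖ ≤ ‖H s (σ s)‖ := by
  induction n with
  | zero =>
    exact ⟨SimpleFunc.const Ω (x 0), fun _ => hx 0, fun s i hi => by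
      rw [Nat.le_zero.mp hi]; rfl⟩
  | succ n ih =>
    obtain ⟨σ, hσ1, hσ⟩ := ih
    have hmeas : MeasurableSet {s | ‖H s (x (n + 1))‖ ≤ ‖H s (σ s)‖} := by
      have h1 : StronglyMeasurable fun s => ‖H s (σ s)‖ := by
        have : (fun s => H s (σ s)) = fun s => ∑ y ∈ σ.range, (σ ⁻¹' {y}).indicator
            (fun s => H s y) s := by
          ext s
          rw [Finset.sum_eq_single (σ s)]
          · simp
          · intro y _ hy
            rw [indicator_of_notMem]
            exact fun h => hy (by simpa using h.symm)
          · intro h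
            exact absurd (SimpleFunc.mem_range_self σ s) h
        refine StronglyMeasurable.norm ?_
        rw [this]
        exact Finset.stronglyMeasurable_fun_sum _ fun y _ =>
          (hH y).indicator (σ.measurableSet_fiber y)
      exact measurableSet_le (hH _).norm.measurable h1.measurable
    refine ⟨SimpleFunc.piecewise _ hmeas σ (SimpleFunc.const Ω (x (n + 1))), fun s => ?_,
      fun s i hi => ?_⟩
    · by_cases h : ‖H s (x (n + 1))‖ ≤ ‖H s (σ s)‖
      · simpa [h] using hσ1 s
      · simpa [h] using hx (n + 1)
    · by_cases h : ‖H s (x (n + 1))‖ ≤ ‖H s (σ s)‖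
      · have : (SimpleFunc.piecewise _ hmeas σ (SimpleFunc.const Ω (x (n + 1)))) s = σ s := by
          simp [h]
        rw [this]
        rcases Nat.le_succ_iff.mp hi with hi | rfl
        · exact hσ s i hi
        · exact h
      · have : (SimpleFunc.piecewise _ hmeas σ (SimpleFunc.const Ω (x (n + 1)))) s = x (n + 1) := by
          simp [h]
        rw [this]
        rcases Nat.le_succ_iff.mp hi with hi | rfl
        · exact (hσ s i hi).trans (not_le.mp h).le
        · exact le_rfl

/-- If `s ↦ H s (p s)` is integrable for all square integrable `p`, its integral is controlled by
the norm of `p`. -/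
lemma exists_lintegral_apply_le [CompleteSpace E] [CompleteSpace F] {H : Ω → E →L[ℂ] F}
    (h : ∀ p : Lp E 2 ν, Integrable (fun s => H s (p s)) ν) :
    ∃ C : ℝ, 0 ≤ C ∧ ∀ p : Lp E 2 ν, ∫ s, ‖H s (p s)‖ ∂ν ≤ C * ‖p‖ := by
  let Q : Lp E 2 ν →ₗ[ℂ] Lp F 1 ν :=
    { toFun := fun p => (h p).toL1 _
      map_add' := fun p q => by
        rw [← Integrable.toL1_add]
        refine (Integrable.toL1_eq_toL1_iff _ _ _ _).mpr ?_
        filter_upwards [Lp.coeFn_add p q] with s hs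
        rw [hs, Pi.add_apply, map_add, Pi.add_apply]
      map_smul' := fun c p => by
        rw [RingHom.id_apply, ← Integrable.toL1_smul]
        refine (Integrable.toL1_eq_toL1_iff _ _ _ ((h p).smul c)).mpr ?_
        filter_upwards [Lp.coeFn_smul c p] with s hs
        rw [hs, Pi.smul_apply, map_smul, Pi.smul_apply] }
  have hQ : ∀ p, Q p =ᵐ[ν] fun s => H s (p s) := fun p => (h p).coeFn_toL1
  have hcont : Continuous Q := by
    -- Closed graph: along a common subsequence both limits hold almost everywhere, and each `H s`
    -- is continuous, so the limits agree.
    refine Q.continuous_of_seq_closed_graph fun u p q hu hQu => ?_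
    obtain ⟨φ, hφ, hφu⟩ := (tendstoInMeasure_of_tendsto_Lp hu).exists_seq_tendsto_ae
    obtain ⟨ψ, hψ, hψQ⟩ := (tendstoInMeasure_of_tendsto_Lp
      (hQu.comp hφ.tendsto_atTop)).exists_seq_tendsto_ae
    refine Lp.ext ?_
    filter_upwards [hφu, hψQ, hQ p, ae_all_iff.mpr fun n => hQ (u n)] with s h1 h2 h3 h4
    rw [h3]
    refine tendsto_nhds_unique h2 ?_
    have h5 := ((H s).continuous.tendsto _).comp (h1.comp hψ.tendsto_atTop)
    refine h5.congr fun n => ?_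
    exact (h4 _).symm
  let Q' : Lp E 2 ν →L[ℂ] Lp F 1 ν := ⟨Q, hcont⟩
  refine ⟨‖Q'‖, ContinuousLinearMap.opNorm_nonneg Q', fun p => ?_⟩
  have h1 := Q'.le_opNorm p
  refine le_trans (le_of_eq ?_) h1
  show _ = ‖Q p‖
  rw [L1.norm_eq_integral_norm]
  exact integral_congr_ae ((hQ p).mono fun s hs => by simp only [hs])

/-- If `s ↦ H s (p s)` is integrable for all square integrable `p`, then `‖H‖` is square
integrable. -/
lemma lintegral_enorm_sq_lt_top [CompleteSpace E] [CompleteSpace F] [IsFiniteMeasure ν]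
    {H : Ω → E →L[ℂ] F} (hH : ∀ x, StronglyMeasurable fun s => H s x)
    {x : ℕ → E} (hx : ∀ n, ‖x n‖ ≤ 1) (hnorm : ∀ s, ∀ q < ‖H s‖, ∃ n, q < ‖H s (x n)‖)
    (h : ∀ p : Lp E 2 ν, Integrable (fun s => H s (p s)) ν) :
    ∫⁻ s, ‖H s‖ₑ ^ (2 : ℝ) ∂ν < ⊤ := by
  obtain ⟨C, hC0, hC⟩ := exists_lintegral_apply_le h
  choose σ hσ1 hσ using exists_simple_selection hH hx
  let g : ℕ → Ω → ℝ := fun n s => ‖H s (σ n s)‖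
  have hgm : ∀ n, AEStronglyMeasurable (g n) ν := fun n =>
    (aestronglyMeasurable_apply hH (σ n).stronglyMeasurable.aestronglyMeasurable).norm
  -- Truncation makes the test function `k n • σ n` bounded, hence in `L²`. On it `‖H s (p s)‖`
  -- equals `k n s ^ 2`.
  let k : ℕ → Ω → ℝ := fun n s => if g n s ≤ n then g n s else 0
  have hkm : ∀ n, AEStronglyMeasurable (k n) ν := by
    intro n
    have : k n = (fun y : ℝ => if y ≤ n then y else 0) ∘ g n := rfl
    rw [this]
    refine (Measurable.comp_aemeasurable ?_ (hgm n).aemeasurable).aestronglyMeasurable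
    exact Measurable.ite measurableSet_Iic measurable_id measurable_const
  have hk0 : ∀ n s, 0 ≤ k n s := fun n s => by
    simp only [k]; split_ifs <;> simp [g]
  have hkn : ∀ n s, k n s ≤ n := fun n s => by
    simp only [k]; split_ifs with hh
    · exact hh
    · positivity
  have hkg : ∀ n s, k n s * g n s = k n s ^ 2 := fun n s => by
    simp only [k]; split_ifs <;> ring
  have hpm : ∀ n, MemLp (fun s => (k n s : ℂ) • σ n s) 2 ν := by
    intro n
    refine MemLp.of_bound (C := n) ?_ (Eventually.of_forall fun s => ?_)
    · exact (Complex.continuous_ofReal.comp_aestronglyMeasurable (hkm n)).smul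
        (σ n).stronglyMeasurable.aestronglyMeasurable
    · rw [norm_smul, Complex.norm_real, Real.norm_of_nonneg (hk0 n s)]
      exact (mul_le_of_le_one_right (hk0 n s) (hσ1 n s)).trans (hkn n s)
  have hkL : ∀ n, MemLp (k n) 2 ν := fun n => MemLp.of_bound (hkm n) n
    (Eventually.of_forall fun s => by rw [Real.norm_of_nonneg (hk0 n s)]; exact hkn n s)
  have hbound : ∀ n, ∫⁻ s, ‖k n s‖ₑ ^ (2 : ℝ) ∂ν ≤ ENNReal.ofReal (C ^ 2) := by
    intro n
    have h1 := hC ((hpm n).toLp _)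
    have h2 : ∫ s, ‖H s (((hpm n).toLp _ : Lp E 2 ν) s)‖ ∂ν = ∫ s, k n s ^ 2 ∂ν := by
      refine integral_congr_ae ?_
      filter_upwards [(hpm n).coeFn_toLp] with s hs
      rw [hs, map_smul, norm_smul, Complex.norm_real, Real.norm_of_nonneg (hk0 n s)]
      exact hkg n s
    have h3 : eLpNorm (k n) 2 ν = ENNReal.ofReal (Real.sqrt (∫ s, k n s ^ 2 ∂ν)) := by
      rw [(hkL n).eLpNorm_eq_integral_rpow_norm (by simp) (by simp), Real.sqrt_eq_rpow]
      simp
    have h4 : ‖(hpm n).toLp _‖ ≤ Real.sqrt (∫ s, k n s ^ 2 ∂ν) := by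
      rw [Lp.norm_toLp]
      refine ENNReal.toReal_le_of_le_ofReal (Real.sqrt_nonneg _) ?_
      rw [← h3]
      refine eLpNorm_mono fun s => ?_
      rw [norm_smul, Complex.norm_real]
      exact mul_le_of_le_one_right (norm_nonneg _) (hσ1 n s)
    set A := ∫ s, k n s ^ 2 ∂ν
    have hA : 0 ≤ A := integral_nonneg fun s => sq_nonneg _
    -- The bound is linear in `‖p‖ ≤ √A` while its left side is `A`. This gives `A ≤ C²` uniformly
    -- in `n`, and Fatou's lemma then passes to `‖H‖`.
    have h5 : A ≤ C * Real.sqrt A := by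
      rw [h2] at h1
      exact h1.trans (mul_le_mul_of_nonneg_left h4 hC0)
    have h6 : A ≤ C ^ 2 := by
      have hs := Real.sq_sqrt hA
      have hs0 := Real.sqrt_nonneg A
      nlinarith [sq_nonneg (C - Real.sqrt A)]
    have h7 : ∫⁻ s, ‖k n s‖ₑ ^ (2 : ℝ) ∂ν = ENNReal.ofReal A := by
      rw [ofReal_integral_eq_lintegral_ofReal (hkL n).integrable_sq
        (Eventually.of_forall fun s => sq_nonneg _)]
      refine lintegral_congr fun s => ?_
      rw [← ofReal_norm, ENNReal.ofReal_rpow_of_nonneg (norm_nonneg _) (by norm_num),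
        Real.norm_of_nonneg (hk0 n s)]
      norm_num
    rw [h7]
    exact ENNReal.ofReal_le_ofReal h6
  have hlim : ∀ s, Tendsto (fun n => k n s) atTop (𝓝 ‖H s‖) := by
    intro s
    have hle : ∀ n, g n s ≤ ‖H s‖ := fun n => (H s).unit_le_opNorm _ (hσ1 n s)
    have hev : ∀ᶠ n : ℕ in atTop, k n s = g n s := by
      obtain ⟨N, hN⟩ := exists_nat_ge ‖H s‖
      filter_upwards [eventually_ge_atTop N] with n hn
      exact if_pos ((hle n).trans (hN.trans (by exact_mod_cast hn)))
    refine Tendsto.congr' (hev.mono fun _ => Eq.symm) ?_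
    refine tendsto_order.mpr ⟨fun q hq => ?_, fun q hq => Eventually.of_forall fun n =>
      (hle n).trans_lt hq⟩
    obtain ⟨i, hi⟩ := hnorm s q hq
    filter_upwards [eventually_ge_atTop i] with n hn
    exact hi.trans_le (hσ n s i hn)
  have hfatou := lintegral_liminf_le' (μ := ν) (u := atTop) (f := fun n s => ‖k n s‖ₑ ^ (2 : ℝ))
    fun n => (hkm n).enorm.pow_const _
  have hlim2 : ∀ s, liminf (fun n => ‖k n s‖ₑ ^ (2 : ℝ)) atTop = ‖H s‖ₑ ^ (2 : ℝ) := by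
    intro s
    have := ((ENNReal.continuous_rpow_const (y := 2)).comp continuous_enorm).tendsto _ |>.comp
      (hlim s)
    have h8 := this.liminf_eq
    simpa [Function.comp_def] using h8
  simp_rw [hlim2] at hfatou
  refine lt_of_le_of_lt (hfatou.trans (liminf_le_of_le (f := atTop) (by isBoundedDefault) ?_))
    (ENNReal.ofReal_lt_top (r := C ^ 2))
  intro b hb
  obtain ⟨n, hn⟩ := hb.exists
  exact hn.trans (hbound n)

end Families
-- Convolution with a square integrable kernel
section Convolution

open Filter Topology

variable {E F : Type*} [NormedAddCommGroup E] [InnerProductSpace ℂ E]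
  [NormedAddCommGroup F] [InnerProductSpace ℂ F] {R : ℝ → E →L[ℂ] F} {a t : ℝ}

/-- The `L²` norm of `r ↦ ‖R r‖` on `(0, a]`. -/
noncomputable def kernelNorm (R : ℝ → E →L[ℂ] F) (a : ℝ) : ENNReal :=
  eLpNorm (fun r => ‖causal R r‖) 2 (volume.restrict (Iic a))

/-- The convolution `∫₀ᵗ R (t - s) (p s) ds`, for `t ≤ a` and `p` on `[0, a]`. -/
noncomputable def conv (R : ℝ → E →L[ℂ] F) (a t : ℝ) (p : ℝ → E) : F :=
  ∫ s in Icc 0 a, causal R (t - s) (p s)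

/-- The reflection `s ↦ t - s` preserves Lebesgue measure and carries `[0, a]` into `(-∞, a]`. The
bound is thus uniform in `t ≤ a`. -/
lemma eLpNorm_causal_sub_le (hR : ∀ x, ContinuousOn (fun r => R r x) (Ioi 0)) (ht : t ≤ a) :
    eLpNorm (fun s => ‖causal R (t - s)‖) 2 (volume.restrict (Icc 0 a)) ≤ kernelNorm R a := by
  have hmp := (Measure.measurePreserving_sub_left (volume : Measure ℝ) t).restrict_preimage
    (measurableSet_Iic (a := a))
  have h1 := eLpNorm_comp_measurePreserving (p := 2)
    (measurable_norm_causal hR).aestronglyMeasurable hmp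
  rw [kernelNorm, ← h1]
  refine eLpNorm_mono_measure _ (Measure.restrict_mono ?_ le_rfl)
  intro s hs
  show t - s ≤ a
  linarith [hs.1]

lemma stronglyMeasurable_causal_sub (hR : ∀ x, ContinuousOn (fun r => R r x) (Ioi 0)) (t : ℝ)
    (x : E) : StronglyMeasurable fun s => causal R (t - s) x :=
  (stronglyMeasurable_causal hR x).comp_measurable (measurable_const.sub measurable_id)

lemma aestronglyMeasurable_conv (hR : ∀ x, ContinuousOn (fun r => R r x) (Ioi 0))
    {p : ℝ → E} {ν : Measure ℝ} (hp : AEStronglyMeasurable p ν) :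
    AEStronglyMeasurable (fun s => causal R (t - s) (p s)) ν :=
  aestronglyMeasurable_apply (stronglyMeasurable_causal_sub hR t) hp

/-- Cauchy–Schwarz applied to `‖R (t - s)‖ * ‖p s‖`. -/
lemma eLpNorm_conv_le (hR : ∀ x, ContinuousOn (fun r => R r x) (Ioi 0)) (ht : t ≤ a)
    {p : ℝ → E} (hp : AEStronglyMeasurable p (volume.restrict (Icc 0 a))) :
    eLpNorm (fun s => causal R (t - s) (p s)) 1 (volume.restrict (Icc 0 a)) ≤
      kernelNorm R a * eLpNorm p 2 (volume.restrict (Icc 0 a)) := by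
  have hm : AEStronglyMeasurable (fun s => ‖causal R (t - s)‖) (volume.restrict (Icc 0 a)) :=
    ((measurable_norm_causal hR).comp (measurable_const.sub measurable_id)).aestronglyMeasurable
  have h1 : eLpNorm (fun s => causal R (t - s) (p s)) 1 (volume.restrict (Icc 0 a)) ≤
      eLpNorm ((fun s => ‖causal R (t - s)‖) • fun s => ‖p s‖) 1 (volume.restrict (Icc 0 a)) := by
    refine eLpNorm_mono_real fun s => ?_
    exact (causal R (t - s)).le_opNorm _
  have h2 := eLpNorm_smul_le_mul_eLpNorm (p := 2) (q := 2) (r := 1) hp.norm hm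
  rw [eLpNorm_norm p] at h2
  exact h1.trans (h2.trans (mul_le_mul_left (eLpNorm_causal_sub_le hR ht) _))

lemma integrableOn_conv (hR : ∀ x, ContinuousOn (fun r => R r x) (Ioi 0))
    (hN : kernelNorm R a ≠ ⊤) (ht : t ≤ a) {p : ℝ → E}
    (hp : MemLp p 2 (volume.restrict (Icc 0 a))) :
    IntegrableOn (fun s => causal R (t - s) (p s)) (Icc 0 a) := by
  rw [IntegrableOn, ← memLp_one_iff_integrable]
  exact ⟨aestronglyMeasurable_conv hR hp.1, lt_of_le_of_lt (eLpNorm_conv_le hR ht hp.1)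
    (ENNReal.mul_lt_top hN.lt_top hp.2)⟩

lemma norm_conv_le (hR : ∀ x, ContinuousOn (fun r => R r x) (Ioi 0))
    (hN : kernelNorm R a ≠ ⊤) (ht : t ≤ a) {p : ℝ → E}
    (hp : MemLp p 2 (volume.restrict (Icc 0 a))) :
    ‖conv R a t p‖ ≤ (kernelNorm R a).toReal *
      (eLpNorm p 2 (volume.restrict (Icc 0 a))).toReal := by
  rw [← ENNReal.toReal_mul]
  refine (ENNReal.ofReal_le_iff_le_toReal (ENNReal.mul_ne_top hN hp.2.ne)).mp ?_
  rw [ofReal_norm]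
  refine (enorm_integral_le_lintegral_enorm _).trans ?_
  rw [← eLpNorm_one_eq_lintegral_enorm]
  exact eLpNorm_conv_le hR ht hp.1

/-- The convolution as a family of bounded operators on `L²`. -/
lemma exists_convCLM (hR : ∀ x, ContinuousOn (fun r => R r x) (Ioi 0))
    (hN : kernelNorm R a ≠ ⊤) :
    ∃ C : ℝ → L2J a E →L[ℂ] F, ∀ t ≤ a, (∀ p : L2J a E, C t p = conv R a t p) ∧
      ‖C t‖ ≤ (kernelNorm R a).toReal := by
  have key : ∀ t, ∃ C : L2J a E →L[ℂ] F, t ≤ a → (∀ p : L2J a E, C p = conv R a t p) ∧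
      ‖C‖ ≤ (kernelNorm R a).toReal := by
    intro t
    by_cases ht : t ≤ a
    · have hint : ∀ p : L2J a E, IntegrableOn (fun s => causal R (t - s) (p s)) (Icc 0 a) :=
        fun p => integrableOn_conv hR hN ht (Lp.memLp p)
      let C₀ : L2J a E →ₗ[ℂ] F :=
        { toFun := fun p => conv R a t p
          map_add' := fun p q => by
            rw [conv, conv, conv, ← integral_add (hint p) (hint q)]
            refine integral_congr_ae ?_
            filter_upwards [Lp.coeFn_add p q] with s hs
            rw [hs, Pi.add_apply, map_add]
          map_smul' := fun c p => by
            rw [conv, conv, RingHom.id_apply, ← integral_smul]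
            refine integral_congr_ae ?_
            filter_upwards [Lp.coeFn_smul c p] with s hs
            rw [hs, Pi.smul_apply, map_smul] }
      have hb : ∀ p, ‖C₀ p‖ ≤ (kernelNorm R a).toReal * ‖p‖ := fun p =>
        norm_conv_le hR hN ht (Lp.memLp p)
      exact ⟨C₀.mkContinuous _ hb, fun _ => ⟨fun p => rfl,
        C₀.mkContinuous_norm_le ENNReal.toReal_nonneg hb⟩⟩
    · exact ⟨0, fun h => absurd h ht⟩
  choose C hC using key
  exact ⟨C, hC⟩

lemma integrableOn_norm_causal (hR : ∀ x, ContinuousOn (fun r => R r x) (Ioi 0))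
    (hN : kernelNorm R a ≠ ⊤) : IntegrableOn (fun r => ‖causal R r‖) (Ioc 0 a) := by
  have h : MemLp (fun r => ‖causal R r‖) 2 (volume.restrict (Ioc 0 a)) :=
    ⟨(measurable_norm_causal hR).aestronglyMeasurable, lt_of_le_of_lt
      (eLpNorm_mono_measure _ (Measure.restrict_mono (fun r hr => hr.2) le_rfl)) hN.lt_top⟩
  exact h.integrable one_le_two

/-- The substitution `r = t - s` moves `t` from the operator family into the continuous function
`g`; dominated convergence with the bound `‖R r‖ * C` applies. -/
lemma continuousOn_conv_of_bounded (hR : ∀ x, ContinuousOn (fun r => R r x) (Ioi 0))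
    (hN : kernelNorm R a ≠ ⊤) {g : ℝ → E} (hg : Continuous g) {C : ℝ} (hC : ∀ s, ‖g s‖ ≤ C) :
    ContinuousOn (fun t => conv R a t g) (Iic a) := by
  have hrw : ∀ t, conv R a t g =
      ∫ r, (Icc 0 a).indicator (fun _ => causal R r (g (t - r))) (t - r) := by
    intro t
    rw [conv, ← integral_indicator measurableSet_Icc,
      ← integral_sub_left_eq_self (μ := volume) _ t]
    refine integral_congr_ae (Eventually.of_forall fun r => ?_)
    simp only [indicator, sub_sub_cancel]
  simp_rw [hrw]
  intro t₀ ht₀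
  have hC0 : 0 ≤ C := (norm_nonneg _).trans (hC 0)
  refine continuousWithinAt_of_dominated
    (bound := (Ioc 0 a).indicator fun r => ‖causal R r‖ * C) ?_ ?_ ?_ ?_
  · refine Eventually.of_forall fun t => ?_
    have h1 : AEStronglyMeasurable (fun r => causal R r (g (t - r))) volume :=
      aestronglyMeasurable_apply (stronglyMeasurable_causal hR)
        (hg.comp (continuous_const.sub continuous_id)).aestronglyMeasurable
    have h2 : MeasurableSet ((fun r => t - r) ⁻¹' Icc 0 a) :=
      (measurable_const.sub measurable_id) measurableSet_Icc
    exact h1.indicator h2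
  · filter_upwards [self_mem_nhdsWithin] with t ht
    refine Eventually.of_forall fun r => ?_
    by_cases h : t - r ∈ Icc 0 a
    · rw [indicator_of_mem h]
      rcases lt_or_ge 0 r with hr | hr
      · have ht' : t ≤ a := ht
        rw [indicator_of_mem (show r ∈ Ioc 0 a from ⟨hr, by linarith [h.1]⟩)]
        exact ((causal R r).le_opNorm _).trans
          (mul_le_mul_of_nonneg_left (hC _) (norm_nonneg _))
      · rw [causal_of_nonpos R hr, zero_apply, norm_zero]
        exact indicator_nonneg (fun _ _ => by positivity) _
    · rw [indicator_of_notMem h, norm_zero]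
      exact indicator_nonneg (fun _ _ => by positivity) _
  · exact IntegrableOn.integrable_indicator ((integrableOn_norm_causal hR hN).mul_const C)
      measurableSet_Ioc
  -- For `r > 0` and `t ≤ a` the condition `t - r ≤ a` is automatic, so the indicator can jump only
  -- at `r = t₀`.
  · have hne : ∀ᵐ r : ℝ, r ≠ t₀ := by simp [ae_iff]
    filter_upwards [hne] with r hr
    have hcont : ContinuousAt (fun t => causal R r (g (t - r))) t₀ :=
      ((causal R r).continuous.comp (hg.comp (continuous_id.sub continuous_const))).continuousAt
    rcases lt_or_ge 0 r with hr0 | hr0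
    · rcases lt_or_gt_of_ne hr with h | h
      · have ht0' : t₀ ≤ a := ht₀
        have hev : ∀ᶠ t in 𝓝[Iic a] t₀, (Icc 0 a).indicator
            (fun _ => causal R r (g (t - r))) (t - r) = causal R r (g (t - r)) := by
          filter_upwards [self_mem_nhdsWithin, mem_nhdsWithin_of_mem_nhds (lt_mem_nhds h)]
            with t ht1 ht2
          have ht1' : t ≤ a := ht1
          exact indicator_of_mem (show t - r ∈ Icc 0 a from ⟨by linarith, by linarith⟩) _
        exact hcont.continuousWithinAt.congr_of_eventuallyEq hev
          (indicator_of_mem (show t₀ - r ∈ Icc 0 a from ⟨by linarith, by linarith⟩) _)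
      · have hev : ∀ᶠ t in 𝓝[Iic a] t₀, (Icc 0 a).indicator
            (fun _ => causal R r (g (t - r))) (t - r) = (0 : F) := by
          filter_upwards [mem_nhdsWithin_of_mem_nhds (gt_mem_nhds h)] with t ht2
          exact indicator_of_notMem (fun hm => by linarith [hm.1]) _
        exact continuousWithinAt_const.congr_of_eventuallyEq hev
          (indicator_of_notMem (fun hm => by linarith [hm.1]) _)
    · have : (fun t => (Icc 0 a).indicator (fun _ => causal R r (g (t - r))) (t - r)) =
          fun _ => (0 : F) := by
        funext t
        rw [causal_of_nonpos R hr0]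
        simp
      rw [this]
      exact continuousWithinAt_const

/-- Bounded continuous functions are dense in `L²`, and `norm_conv_le` makes the approximation
uniform in `t ≤ a`. -/
lemma continuousOn_conv (hR : ∀ x, ContinuousOn (fun r => R r x) (Ioi 0))
    (hN : kernelNorm R a ≠ ⊤) {p : ℝ → E} (hp : MemLp p 2 (volume.restrict (Icc 0 a))) :
    ContinuousOn (fun t => conv R a t p) (Iic a) := by
  refine continuousOn_of_uniform_approx_of_continuousOn fun u hu => ?_
  obtain ⟨ε, hε, hεu⟩ := Metric.mem_uniformity_dist.mp hu
  set K := (kernelNorm R a).toReal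
  have hK : 0 ≤ K := ENNReal.toReal_nonneg
  have hη : 0 < ε / (2 * (K + 1)) := by positivity
  let _ : NormedSpace ℝ E := NormedSpace.complexToReal
  obtain ⟨g, hg, hgm⟩ := hp.exists_boundedContinuous_eLpNorm_sub_le (by simp)
    (ENNReal.ofReal_pos.mpr hη).ne'
  obtain ⟨C, hC⟩ := g.isBounded_range.exists_norm_le
  refine ⟨fun t => conv R a t g, continuousOn_conv_of_bounded hR hN g.continuous
    (fun s => hC _ (mem_range_self s)), fun t ht => hεu ?_⟩
  have hsub : conv R a t p - conv R a t g = conv R a t (p - ⇑g) := by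
    rw [conv, conv, conv, ← integral_sub (integrableOn_conv hR hN ht hp)
      (integrableOn_conv hR hN ht hgm)]
    simp only [Pi.sub_apply, map_sub]
  rw [dist_eq_norm, hsub]
  refine lt_of_le_of_lt (norm_conv_le hR hN ht (hp.sub hgm)) ?_
  have h1 : (eLpNorm (p - ⇑g) 2 (volume.restrict (Icc 0 a))).toReal ≤ ε / (2 * (K + 1)) :=
    ENNReal.toReal_le_of_le_ofReal hη.le hg
  calc K * _ ≤ K * (ε / (2 * (K + 1))) := mul_le_mul_of_nonneg_left h1 hK
    _ < ε := by
      rw [mul_div_assoc', div_lt_iff₀ (by positivity)]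
      nlinarith

end Convolution
-- Square integrability of the kernel and compactness of the convolution
section KernelBounds

open Filter Topology

variable {E F : Type*} [NormedAddCommGroup E] [InnerProductSpace ℂ E]
  [NormedAddCommGroup F] [InnerProductSpace ℂ F] {R : ℝ → E →L[ℂ] F} {a : ℝ}

/-- A strongly continuous family is bounded on compact sets. -/
lemma exists_norm_le_of_isCompact [CompleteSpace E] {K : Set ℝ} (hK : IsCompact K)
    (hR : ∀ x, ContinuousOn (fun r => R r x) K) : ∃ M, 0 ≤ M ∧ ∀ r ∈ K, ‖R r‖ ≤ M := by
  obtain ⟨M, hM⟩ := banach_steinhaus (g := fun r : K => R r) fun x => by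
    obtain ⟨C, hC⟩ := hK.exists_bound_of_continuousOn (hR x)
    exact ⟨C, fun r => hC r r.2⟩
  exact ⟨max M 0, le_max_right _ _, fun r hr => (hM ⟨r, hr⟩).trans (le_max_left _ _)⟩

lemma kernelNorm_ne_top_iff : kernelNorm R a ≠ ⊤ ↔
    ∫⁻ r in Iic a, ‖causal R r‖ₑ ^ (2 : ℝ) < ⊤ := by
  rw [kernelNorm, ← lt_top_iff_ne_top,
    eLpNorm_lt_top_iff_lintegral_rpow_enorm_lt_top (by simp) (by simp)]
  simp

/-- If the convolution at time `a` is absolutely convergent near `s = a` for every square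
integrable function, then the kernel is square integrable in operator norm. -/
lemma kernelNorm_ne_top_of_integrableOn [CompleteSpace E] [CompleteSpace F]
    (hR : ∀ x, ContinuousOn (fun r => R r x) (Ioi 0)) {δ : ℝ} (hδ : 0 < δ) (hδa : δ ≤ a)
    (h : ∀ p : L2J a E, IntegrableOn (fun s => R (a - s) (p s)) (Ioo (a - δ) a)) :
    kernelNorm R a ≠ ⊤ := by
  have hpre : (fun s : ℝ => a - s) ⁻¹' Ioo 0 δ = Ioo (a - δ) a := by
    ext s; simp only [mem_preimage, mem_Ioo]; constructor <;> rintro ⟨h1, h2⟩ <;>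
      constructor <;> linarith
  have hmp : MeasurePreserving (fun s : ℝ => a - s) (volume.restrict (Ioo (a - δ) a))
      (volume.restrict (Ioo 0 δ)) := by
    have := (Measure.measurePreserving_sub_left (volume : Measure ℝ) a).restrict_preimage
      (measurableSet_Ioo (a := 0) (b := δ))
    rwa [hpre] at this
  have hsub : Ioo (a - δ) a ⊆ Icc 0 a := fun s hs => ⟨by linarith [hs.1], hs.2.le⟩
  have hint : ∀ q : Lp E 2 (volume.restrict (Ioo 0 δ)),
      Integrable (fun r => causal R r (q r)) (volume.restrict (Ioo 0 δ)) := by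
    intro q
    have h1 : MemLp (fun s => q (a - s)) 2 (volume.restrict (Ioo (a - δ) a)) :=
      (Lp.memLp q).comp_measurePreserving hmp
    have h2 : MemLp ((Ioo (a - δ) a).indicator fun s => q (a - s)) 2
        (volume.restrict (Icc 0 a)) :=
      ((memLp_indicator_iff_restrict measurableSet_Ioo).mpr h1).mono_measure
        Measure.restrict_le_self
    have h3 := h (h2.toLp _)
    have h4 : IntegrableOn (fun s => causal R (a - s) (q (a - s))) (Ioo (a - δ) a) := by
      refine Integrable.congr h3 ?_
      filter_upwards [ae_restrict_of_ae_restrict_of_subset hsub h2.coeFn_toLp,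
        ae_restrict_mem measurableSet_Ioo] with s hs hsm
      rw [hs, indicator_of_mem hsm, causal_of_pos R (sub_pos.mpr hsm.2)]
    refine (hmp.integrable_comp ?_).mp h4
    exact aestronglyMeasurable_apply (stronglyMeasurable_causal hR) (Lp.memLp q).1
  obtain ⟨x, hx1, hx⟩ := exists_norming_seq hR
  have hnear := lintegral_enorm_sq_lt_top (stronglyMeasurable_causal hR) hx1 hx hint
  -- Only `r = 0` can be singular: on `[δ, a]` the uniform boundedness principle bounds the family.
  obtain ⟨M, hM0, hM⟩ := exists_norm_le_of_isCompact (isCompact_Icc (a := δ) (b := a))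
    fun x => (hR x).mono fun r hr => hδ.trans_le hr.1
  have hfar : ∫⁻ r in Icc δ a, ‖causal R r‖ₑ ^ (2 : ℝ) < ⊤ := by
    refine setLIntegral_lt_top_of_le_nnreal (by simp) ⟨(M.toNNReal) ^ (2 : ℝ), fun r hr => ?_⟩
    rw [causal_of_pos R (hδ.trans_le hr.1), ENNReal.coe_rpow_of_nonneg _ (by norm_num)]
    refine ENNReal.rpow_le_rpow ?_ (by norm_num)
    rw [← ofReal_norm]
    exact ENNReal.ofReal_le_ofReal (hM r hr)
  have hneg : ∫⁻ r in Iic 0, ‖causal R r‖ₑ ^ (2 : ℝ) = 0 := by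
    rw [setLIntegral_congr_fun (g := fun _ => 0) measurableSet_Iic, lintegral_zero]
    intro r hr
    simp only
    rw [causal_of_nonpos R hr, ← ofReal_norm, norm_zero, ENNReal.ofReal_zero,
      ENNReal.zero_rpow_of_pos (by norm_num)]
  rw [kernelNorm_ne_top_iff]
  have hcover : Iic a ⊆ Iic 0 ∪ (Ioo 0 δ ∪ Icc δ a) := by
    intro r hr
    rcases le_or_gt r 0 with h0 | h0
    · exact Or.inl h0
    · rcases lt_or_ge r δ with h1 | h1
      · exact Or.inr (Or.inl ⟨h0, h1⟩)
      · exact Or.inr (Or.inr ⟨h1, hr⟩)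
  refine lt_of_le_of_lt (lintegral_mono_set hcover) ?_
  refine lt_of_le_of_lt (lintegral_union_le _ _ _) ?_
  rw [hneg, zero_add]
  exact lt_of_le_of_lt (lintegral_union_le _ _ _) (ENNReal.add_lt_top.mpr ⟨hnear, hfar⟩)

/-- The ranges of a strongly continuous family of compact operators lie in a common separable
set. -/
lemma exists_seq_range_subset_closure [CompleteSpace F]
    (hR : ∀ x, ContinuousOn (fun r => R r x) (Ioi 0))
    (hc : ∀ r, 0 < r → IsCompactOperator (R r)) :
    ∃ d : ℕ → F, ∀ r x, causal R r x ∈ closure (range d) := by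
  have hsep1 : ∀ r, 0 < r → TopologicalSpace.IsSeparable (range (R r)) := by
    intro r hr
    have : range (R r) ⊆ ⋃ n : ℕ, closure (R r '' Metric.closedBall 0 n) := by
      rintro _ ⟨x, rfl⟩
      obtain ⟨n, hn⟩ := exists_nat_ge ‖x‖
      exact mem_iUnion.mpr ⟨n, subset_closure ⟨x, mem_closedBall_zero_iff.mpr hn, rfl⟩⟩
    exact (TopologicalSpace.IsSeparable.iUnion fun n : ℕ =>
      ((hc r hr).isCompact_closure_image_closedBall n).isSeparable).mono this
  -- Each range is a countable union of relatively compact sets. By strong continuity rational times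
  -- suffice.
  have hsep : TopologicalSpace.IsSeparable (⋃ q : {q : ℚ // 0 < q}, range (R (q : ℚ))) :=
    TopologicalSpace.IsSeparable.iUnion fun q => hsep1 _ (by exact_mod_cast q.2)
  obtain ⟨c, hc', hcl⟩ := hsep
  obtain ⟨d, hd⟩ := (hc'.insert 0).exists_eq_range (insert_nonempty _ _)
  have hsub : closure (⋃ q : {q : ℚ // 0 < q}, range (R (q : ℚ))) ⊆ closure (range d) :=
    closure_minimal (hcl.trans (closure_mono (hd ▸ subset_insert _ _))) isClosed_closure
  refine ⟨d, fun r x => ?_⟩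
  rcases lt_or_ge 0 r with hr | hr
  · rw [causal_of_pos R hr]
    refine hsub ?_
    rw [mem_closure_iff_nhds]
    intro U hU
    have h1 : (fun r => R r x) ⁻¹' U ∈ 𝓝 r :=
      (hR x).continuousAt (Ioi_mem_nhds hr) hU
    obtain ⟨O, hO, hOo, hrO⟩ := mem_nhds_iff.mp (inter_mem h1 (Ioi_mem_nhds hr))
    obtain ⟨q, hq⟩ := Rat.denseRange_cast.exists_mem_open hOo ⟨r, hrO⟩
    have hq0 : (0 : ℝ) < q := (hO hq).2
    exact ⟨R q x, (hO hq).1, mem_iUnion.mpr ⟨⟨q, by exact_mod_cast hq0⟩, x, rfl⟩⟩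
  · rw [causal_of_nonpos R hr]
    exact subset_closure (hd ▸ mem_insert _ _)

lemma starProjection_isCompactOperator {V : Submodule ℂ F} [FiniteDimensional ℂ V] :
    IsCompactOperator V.starProjection := by
  have : ProperSpace V := FiniteDimensional.proper ℂ V
  have h : IsCompactOperator V.orthogonalProjectionOnto :=
    (isCompactOperator_id (E := V)).comp_clm V.orthogonalProjectionOnto
  exact h.clm_comp V.subtypeL

/-- Projections along an increasing sequence of subspaces eventually capture compact
operators. -/
lemma tendsto_norm_sub_starProjection_comp {d : ℕ → F} {T : E →L[ℂ] F}
    (hT : IsCompactOperator T) (hd : ∀ x, T x ∈ closure (range d)) {V : ℕ → Submodule ℂ F}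
    [∀ n, FiniteDimensional ℂ (V n)] (hV : ∀ i n, i < n → d i ∈ V n) :
    Tendsto (fun n => ‖(1 - (V n).starProjection) ∘L T‖) atTop (𝓝 0) := by
  rw [Metric.tendsto_atTop]
  intro ε hε
  have htb : TotallyBounded (T '' Metric.closedBall 0 1) :=
    (hT.isCompact_closure_image_closedBall 1).totallyBounded.subset subset_closure
  obtain ⟨t, htT, htf, hcov⟩ := Metric.finite_approx_of_totallyBounded htb (ε / 4) (by positivity)
  have hnear : ∀ y ∈ t, ∃ i, dist y (d i) < ε / 4 := by
    intro y hy
    obtain ⟨x, -, rfl⟩ := htT hy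
    obtain ⟨_, ⟨i, rfl⟩, hi⟩ := Metric.mem_closure_iff.mp (hd x) (ε / 4) (by positivity)
    exact ⟨i, hi⟩
  choose! j hj using hnear
  obtain ⟨N, hN⟩ := (htf.image j).bddAbove
  refine ⟨N + 1, fun n hn => ?_⟩
  rw [dist_zero_right, norm_norm]
  refine lt_of_le_of_lt (ContinuousLinearMap.opNorm_le_of_unit_norm (by positivity)
    (C := ε / 2) fun x hx => ?_) (by linarith)
  obtain ⟨y, hy, hxy⟩ := mem_iUnion₂.mp (hcov ⟨x, mem_closedBall_zero_iff.mpr hx.le, rfl⟩)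
  have hmem : d (j y) ∈ V n := hV _ _ (lt_of_le_of_lt (hN ⟨y, hy, rfl⟩) hn)
  -- The complementary projection kills `d (j y)`, so that vector can be subtracted freely; it lies
  -- within `ε / 2` of `T x`.
  have h1 : (1 - (V n).starProjection) (T x) = (V n)ᗮ.starProjection (T x - d (j y)) := by
    rw [map_sub, (V n)ᗮ.starProjection_apply_eq_zero_iff.mpr
      ((V n).le_orthogonal_orthogonal hmem), sub_zero, Submodule.starProjection_orthogonal']
  rw [ContinuousLinearMap.comp_apply, h1]
  refine ((V n)ᗮ.norm_starProjection_apply_le _).trans ?_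
  rw [← dist_eq_norm]
  linarith [dist_triangle (T x) y (d (j y)), hj y hy, Metric.mem_ball.mp hxy]

/-- Convolution with a strongly continuous family of compact operators of square integrable norm
is a compact operator on `L²`. -/
lemma isCompactOperator_conv [CompleteSpace F]
    (hR : ∀ x, ContinuousOn (fun r => R r x) (Ioi 0))
    (hN : kernelNorm R a ≠ ⊤) (hc : ∀ r, 0 < r → IsCompactOperator (R r)) {t : ℝ} (ht : t ≤ a)
    {C : L2J a E →L[ℂ] F} (hC : ∀ p : L2J a E, C p = conv R a t p) : IsCompactOperator C := by
  obtain ⟨d, hd⟩ := exists_seq_range_subset_closure hR hc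
  let V : ℕ → Submodule ℂ F := fun n => Submodule.span ℂ (d '' Iio n)
  have hVfd : ∀ n, FiniteDimensional ℂ (V n) := fun n =>
    FiniteDimensional.span_of_finite ℂ ((finite_Iio n).image d)
  have hV : ∀ i n, i < n → d i ∈ V n := fun i n hin => Submodule.subset_span ⟨i, hin, rfl⟩
  -- `D n ∘L C` is convolution with `D n ∘L R r`, whose norm tends to `0` for each `r` and is
  -- dominated by `‖R r‖`. Hence `D n ∘L C → 0` in norm, and `C` is a norm limit of finite-rank
  -- operators.
  let D : ℕ → F →L[ℂ] F := fun n => 1 - (V n).starProjection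
  let RD : ℕ → ℝ → E →L[ℂ] F := fun n r => D n ∘L R r
  have hRD : ∀ n x, ContinuousOn (fun r => RD n r x) (Ioi 0) := fun n x =>
    (D n).continuous.comp_continuousOn (hR x)
  have hcausal : ∀ n r, causal (RD n) r = D n ∘L causal R r := by
    intro n r
    rcases lt_or_ge 0 r with hr | hr
    · rw [causal_of_pos _ hr, causal_of_pos _ hr]
    · rw [causal_of_nonpos _ hr, causal_of_nonpos _ hr, ContinuousLinearMap.comp_zero]
  have hDnorm : ∀ n (T : E →L[ℂ] F), ‖D n ∘L T‖ ≤ ‖T‖ := by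
    intro n T
    refine (ContinuousLinearMap.opNorm_comp_le _ _).trans ?_
    refine mul_le_of_le_one_left (norm_nonneg _) ?_
    have : D n = (V n)ᗮ.starProjection := (Submodule.starProjection_orthogonal' (V n)).symm
    rw [this]
    exact Submodule.starProjection_norm_le _
  have hcc : ∀ r, IsCompactOperator (causal R r) := by
    intro r
    rcases lt_or_ge 0 r with hr | hr
    · rw [causal_of_pos _ hr]; exact hc r hr
    · rw [causal_of_nonpos _ hr]; exact isCompactOperator_zero
  have hptw : ∀ r, Tendsto (fun n => ‖causal (RD n) r‖) atTop (𝓝 0) := by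
    intro r
    simp_rw [hcausal]
    exact tendsto_norm_sub_starProjection_comp (hcc r) (hd r) hV
  have hN0 := kernelNorm_ne_top_iff.mp hN
  have hle : ∀ n r, ‖causal (RD n) r‖ₑ ^ (2 : ℝ) ≤ ‖causal R r‖ₑ ^ (2 : ℝ) := by
    intro n r
    refine ENNReal.rpow_le_rpow ?_ (by norm_num)
    rw [← ofReal_norm, ← ofReal_norm, hcausal]
    exact ENNReal.ofReal_le_ofReal (hDnorm n _)
  have hlint : Tendsto (fun n => ∫⁻ r in Iic a, ‖causal (RD n) r‖ₑ ^ (2 : ℝ)) atTop (𝓝 0) := by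
    have h1 := tendsto_lintegral_of_dominated_convergence
      (μ := volume.restrict (Iic a)) (F := fun n r => ‖causal (RD n) r‖ₑ ^ (2 : ℝ))
      (f := fun _ => 0) (fun r => ‖causal R r‖ₑ ^ (2 : ℝ)) ?_
      (fun n => Eventually.of_forall (hle n)) hN0.ne ?_
    · simpa using h1
    · intro n
      have := (measurable_norm_causal (hRD n)).ennreal_ofReal.pow_const (2 : ℝ)
      simpa only [ofReal_norm] using this
    · refine Eventually.of_forall fun r => ?_
      have h2 := (ENNReal.continuous_rpow_const (y := 2)).tendsto _ |>.comp
        ((ENNReal.continuous_ofReal.tendsto _).comp (hptw r))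
      simpa [Function.comp_def, ofReal_norm] using h2
  have hkn : Tendsto (fun n => kernelNorm (RD n) a) atTop (𝓝 0) := by
    have h1 : ∀ n, kernelNorm (RD n) a =
        (∫⁻ r in Iic a, ‖causal (RD n) r‖ₑ ^ (2 : ℝ)) ^ (1 / 2 : ℝ) := by
      intro n
      rw [kernelNorm, eLpNorm_eq_lintegral_rpow_enorm_toReal (by simp) (by simp)]
      simp
    simp_rw [h1]
    have h2 := (ENNReal.continuous_rpow_const (y := 1 / 2)).tendsto _ |>.comp hlint
    simpa [Function.comp_def] using h2
  have hkfin : ∀ n, kernelNorm (RD n) a ≠ ⊤ := fun n =>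
    kernelNorm_ne_top_iff.mpr ((lintegral_mono fun r => hle n r).trans_lt hN0)
  have hDC : ∀ n, ‖D n ∘L C‖ ≤ (kernelNorm (RD n) a).toReal := by
    intro n
    refine ContinuousLinearMap.opNorm_le_bound _ ENNReal.toReal_nonneg fun p => ?_
    have h1 : (D n ∘L C) p = conv (RD n) a t p := by
      rw [ContinuousLinearMap.comp_apply, hC, conv, conv,
        ← ContinuousLinearMap.integral_comp_comm _ (integrableOn_conv hR hN ht (Lp.memLp p))]
      simp only [hcausal, ContinuousLinearMap.comp_apply]
    rw [h1]
    exact norm_conv_le (hRD n) (hkfin n) ht (Lp.memLp p)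
  have hDC0 : Tendsto (fun n => D n ∘L C) atTop (𝓝 0) := by
    refine tendsto_zero_iff_norm_tendsto_zero.mpr
      (squeeze_zero (fun n => ContinuousLinearMap.opNorm_nonneg (D n ∘L C)) hDC ?_)
    have h2 := (ENNReal.tendsto_toReal ENNReal.zero_ne_top).comp hkn
    simpa [Function.comp_def] using h2
  have hPC : Tendsto (fun n => (V n).starProjection ∘L C) atTop (𝓝 C) := by
    have h2 := (tendsto_const_nhds (x := C)).sub hDC0
    rw [sub_zero] at h2
    refine h2.congr fun n => ?_
    ext p
    simp [D]
  refine isCompactOperator_of_tendsto hPC (Eventually.of_forall fun n => ?_)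
  exact (starProjection_isCompactOperator (V := V n)).comp_clm C

end KernelBounds
-- The Green operators
section Green

open Filter Topology

variable {E : Type*} [NormedAddCommGroup E] [InnerProductSpace ℂ E]
  {T S : ℝ → E →L[ℂ] E} {m : ℕ} {c : Fin m → ℂ} {τ : Fin m → ℝ} {a : ℝ}

lemma green_apply (t s : ℝ) (x : E) :
    green T S c τ t s x =
      ∑ k, c k • T t (nonlocalInv T c τ (causal S (τ k - s) x)) + causal S (t - s) x := by
  have h : ∀ k, chi (τ k) (c k) s • (T t ∘L nonlocalInv T c τ ∘L S (τ k - s)) =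
      c k • (T t ∘L nonlocalInv T c τ ∘L causal S (τ k - s)) := by
    intro k
    rw [← ContinuousLinearMap.comp_smul, ← ContinuousLinearMap.comp_smul, chi_smul_apply,
      ContinuousLinearMap.comp_smul, ContinuousLinearMap.comp_smul]
  rw [green, chi_smul_apply, one_smul, Finset.sum_congr rfl fun k _ => h k,
    add_apply, sum_apply]
  rfl

variable [CompleteSpace E]

lemma norm_le_supNorm (hT : ∀ x, ContinuousOn (fun t => T t x) (Ici 0)) {t : ℝ}
    (ht : t ∈ Icc 0 a) : ‖T t‖ ≤ supNorm a T := by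
  obtain ⟨M, -, hM⟩ := exists_norm_le_of_isCompact (isCompact_Icc (a := 0) (b := a))
    fun x => (hT x).mono Icc_subset_Ici_self
  -- Needed because the real supremum of an unbounded family is `0` by convention.
  have hb : BddAbove (range fun t : Icc (0 : ℝ) a => ‖T t‖) :=
    ⟨M, by rintro _ ⟨t, rfl⟩; exact hM t t.2⟩
  exact le_ciSup hb (⟨t, ht⟩ : Icc (0 : ℝ) a)

/-- Neumann series. Partial sums are allowed because the factor in front of `S (a - s)` near `s = a`
involves the sum over `τ k ≠ a`. -/
lemma isUnit_one_sub_sum (hT : ∀ x, ContinuousOn (fun t => T t x) (Ici 0))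
    (hτ : ∀ k, τ k ∈ Icc (0 : ℝ) a) (hc : supNorm a T * ∑ k, ‖c k‖ < 1) (s : Finset (Fin m)) :
    IsUnit (1 - ∑ k ∈ s, c k • T (τ k)) := by
  refine isUnit_one_sub_of_norm_lt_one (lt_of_le_of_lt ?_ hc)
  refine (norm_sum_le _ _).trans ?_
  rw [Finset.mul_sum]
  refine (Finset.sum_le_sum fun k _ => ?_).trans (Finset.sum_le_sum_of_subset_of_nonneg
    (Finset.subset_univ s) fun k _ _ => ?_)
  · rw [norm_smul, mul_comm]
    exact mul_le_mul_of_nonneg_right (norm_le_supNorm hT (hτ k)) (norm_nonneg _)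
  · exact mul_nonneg ((norm_nonneg _).trans (norm_le_supNorm hT (hτ k))) (norm_nonneg _)

/-- Near `s = a`, the Green function at time `a` is `S (a - s)` followed by an invertible
operator. -/
lemma exists_green_eq_near_end (hT : ∀ x, ContinuousOn (fun t => T t x) (Ici 0)) (ha : 0 < a)
    (hτ : ∀ k, τ k ∈ Icc (0 : ℝ) a) (hc : supNorm a T * ∑ k, ‖c k‖ < 1) :
    ∃ Q : E →L[ℂ] E, IsUnit Q ∧ ∃ δ > 0, δ ≤ a ∧
      ∀ s ∈ Ioo (a - δ) a, ∀ x, green T S c τ a s x = Q (S (a - s) x) := by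
  classical
  let P : E →L[ℂ] E := 1 - ∑ k, c k • T (τ k)
  let P' : E →L[ℂ] E := 1 - ∑ k with τ k ≠ a, c k • T (τ k)
  have hP : IsUnit P := isUnit_one_sub_sum hT hτ hc Finset.univ
  have hP' : IsUnit P' := isUnit_one_sub_sum hT hτ hc _
  have hO : nonlocalInv T c τ = Ring.inverse P := rfl
  -- Near `s = a` only the nonlocal times equal to `a` still contribute. The factor is `1 + ∑ cₖ
  -- T(a) P⁻¹` over those `k`, that is `(P + ∑ cₖ T(a)) P⁻¹ = P' P⁻¹`.
  refine ⟨P' * Ring.inverse P, hP'.mul hP.ringInverse, ?_⟩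
  have hQ : P' * Ring.inverse P =
      1 + ∑ k with τ k = a, c k • (T a * Ring.inverse P) := by
    have h1 : P' = P + ∑ k with τ k = a, c k • T a := by
      have h2 := Finset.sum_filter_add_sum_filter_not Finset.univ (fun k => τ k = a)
        fun k => c k • T (τ k)
      have h3 : ∑ k with τ k = a, c k • T (τ k) = ∑ k with τ k = a, c k • T a :=
        Finset.sum_congr rfl fun k hk => by rw [(Finset.mem_filter.mp hk).2]
      simp only [P, P', ← h2, h3]
      abel
    rw [h1, add_mul, Ring.mul_inverse_cancel _ hP, Finset.sum_mul]
    simp only [smul_mul_assoc]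
  have hδ : ∃ δ > 0, δ ≤ a ∧ ∀ k, τ k ≠ a → τ k ≤ a - δ := by
    have h1 : ∀ᶠ δ in 𝓝[>] (0 : ℝ), ∀ k, τ k ≠ a → τ k ≤ a - δ := by
      rw [eventually_all]
      intro k
      by_cases hk : τ k = a
      · exact Eventually.of_forall fun δ h => absurd hk h
      · have hlt : 0 < a - τ k := sub_pos.mpr (lt_of_le_of_ne (hτ k).2 hk)
        filter_upwards [mem_nhdsWithin_of_mem_nhds (gt_mem_nhds hlt)] with δ hδ _
        linarith
    have h2 : ∀ᶠ δ in 𝓝[>] (0 : ℝ), δ ≤ a := by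
      filter_upwards [mem_nhdsWithin_of_mem_nhds (gt_mem_nhds ha)] with δ hδ using hδ.le
    obtain ⟨δ, hδ1, hδ2, hδ3⟩ := (h1.and (h2.and self_mem_nhdsWithin)).exists
    exact ⟨δ, hδ3, hδ2, hδ1⟩
  obtain ⟨δ, hδ0, hδa, hδ⟩ := hδ
  refine ⟨δ, hδ0, hδa, fun s hs x => ?_⟩
  rw [green_apply, causal_of_pos S (sub_pos.mpr hs.2), hQ, add_apply, add_comm, hO,
    sum_apply, ← Finset.sum_filter_add_sum_filter_not Finset.univ
      (fun k => τ k = a)]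
  have h0 : ∑ k with ¬ τ k = a,
      c k • T a (Ring.inverse P (causal S (τ k - s) x)) = 0 := by
    refine Finset.sum_eq_zero fun k hk => ?_
    have h1 := hδ k (Finset.mem_filter.mp hk).2
    rw [causal_of_nonpos S (by linarith [hs.1]), zero_apply, map_zero, map_zero,
      smul_zero]
  rw [h0, add_zero]
  congr 1
  refine Finset.sum_congr rfl fun k hk => ?_
  rw [(Finset.mem_filter.mp hk).2, causal_of_pos S (sub_pos.mpr hs.2)]
  rfl

/-- Applying the inverse of `Q` near `s = a` turns integrability of the Green function against `p`
into that of `S (a - s) (p s)`. -/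
lemma kernelNorm_ne_top_of_green (hT : ∀ x, ContinuousOn (fun t => T t x) (Ici 0))
    (hS : ∀ x, ContinuousOn (fun r => S r x) (Ioi 0)) (ha : 0 < a)
    (hτ : ∀ k, τ k ∈ Icc (0 : ℝ) a) (hc : supNorm a T * ∑ k, ‖c k‖ < 1)
    (h : ∀ p : L2J a E, IntegrableOn (fun s => green T S c τ a s (p s)) (Icc 0 a)) :
    kernelNorm S a ≠ ⊤ := by
  obtain ⟨Q, hQ, δ, hδ, hδa, hgreen⟩ := exists_green_eq_near_end (S := S) hT ha hτ hc
  refine kernelNorm_ne_top_of_integrableOn hS hδ hδa fun p => ?_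
  have h1 : IntegrableOn (fun s => green T S c τ a s (p s)) (Ioo (a - δ) a) :=
    (h p).mono_set fun s hs => ⟨by linarith [hs.1], hs.2.le⟩
  have h2 := (Ring.inverse Q).integrable_comp h1
  refine Integrable.congr h2 ?_
  filter_upwards [ae_restrict_mem measurableSet_Ioo] with s hs
  rw [hgreen s hs, ← mul_apply_eq_comp, Ring.inverse_mul_cancel _ hQ]
  rfl

/-- The operators `p ↦ ∫₀ᵃ G(t, s) p(s) ds` on `L²`. -/
lemma exists_greenCLM (hT : ∀ x, ContinuousOn (fun t => T t x) (Ici 0))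
    (hS : ∀ x, ContinuousOn (fun r => S r x) (Ioi 0)) (hSc : IsCompactFamily S)
    (hτ : ∀ k, τ k ∈ Icc (0 : ℝ) a) (hN : kernelNorm S a ≠ ⊤) :
    ∃ K : ℝ → L2J a E →L[ℂ] E,
      (∀ t ≤ a, ∀ p : L2J a E,
        IntegrableOn (fun s => green T S c τ t s (p s)) (Icc 0 a) ∧
        K t p = ∫ s in Icc (0 : ℝ) a, green T S c τ t s (p s)) ∧
      (∀ t ≤ a, IsCompactOperator (K t)) ∧
      ∀ p, ContinuousOn (fun t => K t p) (Icc 0 a) := by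
  obtain ⟨C, hC⟩ := exists_convCLM hS hN
  have hCc : ∀ t ≤ a, IsCompactOperator (C t) := fun t ht =>
    isCompactOperator_conv hS hN hSc ht (hC t ht).1
  refine ⟨fun t => ∑ k, c k • (T t ∘L nonlocalInv T c τ ∘L C (τ k)) + C t, fun t ht p => ?_,
    fun t ht => ?_, fun p => ?_⟩
  · simp only [green_apply]
    have hint : ∀ t ≤ a, IntegrableOn (fun s => causal S (t - s) (p s)) (Icc 0 a) :=
      fun t ht => integrableOn_conv hS hN ht (Lp.memLp p)
    have h1 : ∀ k, IntegrableOn (fun s => c k • T t (nonlocalInv T c τ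
        (causal S (τ k - s) (p s)))) (Icc 0 a) := fun k =>
      ((T t).integrable_comp ((nonlocalInv T c τ).integrable_comp (hint _ (hτ k).2))).smul (c k)
    refine ⟨(integrable_finsetSum _ fun k _ => h1 k).add (hint t ht), ?_⟩
    rw [integral_add (integrable_finsetSum _ fun k _ => h1 k) (hint t ht),
      integral_finsetSum _ fun k _ => h1 k]
    simp only [add_apply, sum_apply, smul_apply,
      ContinuousLinearMap.comp_apply, (hC t ht).1 p, (hC (τ _) (hτ _).2).1 p]
    congr 1
    refine Finset.sum_congr rfl fun k _ => ?_
    rw [integral_smul, (T t).integral_comp_comm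
      ((nonlocalInv T c τ).integrable_comp (hint _ (hτ k).2)),
      (nonlocalInv T c τ).integral_comp_comm (hint _ (hτ k).2)]
    rfl
  · have h1 : ∀ s : Finset (Fin m), IsCompactOperator
        (∑ k ∈ s, c k • (T t ∘L nonlocalInv T c τ ∘L C (τ k)) : L2J a E →L[ℂ] E) := by
      intro s
      induction s using Finset.induction_on with
      | empty => rw [Finset.sum_empty]; exact isCompactOperator_zero
      | insert k s hk ih =>
        rw [Finset.sum_insert hk]
        exact (((hCc _ (hτ k).2).clm_comp (T t ∘L nonlocalInv T c τ)).smul (c k)).add ih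
    exact (h1 _).add (hCc t ht)
  · simp only [add_apply, sum_apply, smul_apply,
      ContinuousLinearMap.comp_apply]
    refine ContinuousOn.add (continuousOn_finsetSum _ fun k _ =>
      ((hT _).mono Icc_subset_Ici_self).const_smul (c k)) ?_
    refine ((continuousOn_conv hS hN (Lp.memLp p)).mono Icc_subset_Iic_self).congr
      fun t ht => (hC t ht.2).1 p

end Green
-- Density of the range of the terminal operator
section DenseRange

open Filter Topology

variable {E : Type*} [NormedAddCommGroup E] [InnerProductSpace ℂ E]
  {α : ℝ} {A : E →ₗ.[ℂ] E} {T S : ℝ → E →L[ℂ] E}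

/-- If a functional vanishes on `S r` for all small `r`, its composition with the resolvents
decays exponentially. -/
lemma exists_norm_resolvent_le {φ : E →L[ℂ] ℂ} {δ ω : ℝ}
    (h : ∀ r ∈ Ioo 0 δ, ∀ x, φ (S r x) = 0)
    {R : ℝ → E →L[ℂ] E} [CompleteSpace E]
    (hR : ∀ ξ > ω, ∀ u, IntegrableOn (fun t : ℝ => Complex.exp (-((ξ : ℂ) * t)) • S t u) (Ioi 0) ∧
      R ξ u = ∫ t in Ioi (0 : ℝ), Complex.exp (-((ξ : ℂ) * t)) • S t u) (u : E) :
    ∃ C : ℝ, ∀ ξ ≥ ω + 1, ‖φ (R ξ u)‖ ≤ C * Real.exp (-δ * ξ) := by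
  set ξ₀ := ω + 1
  have hξ₀ : ω < ξ₀ := lt_add_one ω
  have hexp : ∀ ξ t : ℝ, ‖Complex.exp (-((ξ : ℂ) * t))‖ = Real.exp (-(ξ * t)) := fun ξ t => by
    rw [Complex.norm_exp]; norm_num
  have hint₀ := (φ.integrable_comp (hR ξ₀ hξ₀ u).1).norm
  refine ⟨Real.exp (ξ₀ * δ) *
    ∫ t in Ioi (0 : ℝ), ‖φ (Complex.exp (-((ξ₀ : ℂ) * t)) • S t u)‖, fun ξ hξ => ?_⟩
  obtain ⟨h1, h2⟩ := hR ξ (hξ₀.trans_le hξ) u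
  rw [h2, ← φ.integral_comp_comm h1]
  refine (norm_integral_le_integral_norm _).trans ?_
  rw [mul_right_comm, ← integral_const_mul]
  refine setIntegral_mono_on (φ.integrable_comp h1).norm (hint₀.const_mul _) measurableSet_Ioi
    fun t ht => ?_
  have ht0 : 0 < t := ht
  simp only [map_smul, norm_smul, hexp]
  rcases lt_or_ge t δ with htδ | htδ
  · rw [h t ⟨ht, htδ⟩, norm_zero, mul_zero, mul_zero, mul_zero]
  -- The comparison of exponents is `(ξ - ξ₀) * (t - δ) ≥ 0`.
  · rw [← mul_assoc, ← Real.exp_add, ← Real.exp_add]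
    refine mul_le_mul_of_nonneg_right (Real.exp_le_exp.mpr ?_) (norm_nonneg _)
    have hξ' : ξ₀ ≤ ξ := hξ
    nlinarith

/-- A functional vanishing on `D(A)` vanishes on the range of `A`. -/
lemma functional_pmapVal_eq_zero [CompleteSpace E] (hα : 0 < α) (hT : IsSolutionOperator α A T)
    {φ : E →L[ℂ] ℂ} (hφ : ∀ x ∈ A.domain, φ x = 0) {x : E} (hx : x ∈ A.domain) :
    φ (pmapVal A x) = 0 := by
  set w := pmapVal A x
  have hcont : ContinuousOn (fun s => T s w) (Ici 0) := hT.strongly_continuous w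
  have hk : ∀ t : ℝ, IntervalIntegrable (fun s => (t - s) ^ (α - 1)) volume 0 t := by
    intro t
    have := (intervalIntegral.intervalIntegrable_rpow' (a := t) (b := 0)
      (show -1 < α - 1 by linarith)).comp_sub_left t
    simpa using this
  have hkz : ∀ t : ℝ, 0 ≤ t → IntervalIntegrable (fun s => (t - s) ^ (α - 1) • T s w)
      volume 0 t := by
    intro t ht
    refine (hk t).smul_continuousOn (hcont.mono ?_)
    rw [uIcc_of_le ht]
    exact Icc_subset_Ici_self
  -- Since `x` and `T t x` lie in the domain, `φ` annihilates the fractional integral of `T s w`.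
  -- The weighted averages of `φ (T s w)` over `[0, t]` thus vanish, while they tend to `φ w` as `t
  -- → 0`.
  have hzero : ∀ t : ℝ, 0 < t → ∫ s in (0 : ℝ)..t, (t - s) ^ (α - 1) • φ (T s w) = 0 := by
    intro t ht
    have h1 := congrArg φ (hT.integral_eq x hx t ht.le)
    rw [hφ _ (hT.mapsTo_domain t ht.le x hx), map_add, hφ x hx, zero_add,
      φ.map_smul_of_tower] at h1
    have hΓ : (1 / Real.Gamma α) ≠ 0 := one_div_ne_zero (Real.Gamma_pos_of_pos hα).ne'
    have h2 := (smul_eq_zero.mp h1.symm).resolve_left hΓ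
    have h3 : ∫ s in (0 : ℝ)..t, (t - s) ^ (α - 1) • pmapVal A (T s x) =
        ∫ s in (0 : ℝ)..t, (t - s) ^ (α - 1) • T s w := by
      refine intervalIntegral.integral_congr fun s hs => ?_
      rw [uIcc_of_le ht.le] at hs
      simp only [hT.commutes s hs.1 x hx, w]
    rw [h3, ← φ.intervalIntegral_comp_comm (hkz t ht.le)] at h2
    simpa only [φ.map_smul_of_tower] using h2
  refine norm_le_zero_iff.mp (le_of_forall_pos_le_add fun ε hε => ?_)
  rw [zero_add]
  have hT0 : T 0 w = w := by rw [hT.map_zero]; rfl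
  have hev : ∀ᶠ s in 𝓝[Ici 0] (0 : ℝ), ‖φ (T s w) - φ w‖ < ε := by
    have h1 : Tendsto (fun s => φ (T s w)) (𝓝[Ici 0] 0) (𝓝 (φ w)) := by
      have := (φ.continuous.tendsto _).comp (hcont 0 self_mem_Ici)
      simpa only [hT0, Function.comp_def] using this
    have := h1.eventually (Metric.ball_mem_nhds _ hε)
    simpa only [Metric.mem_ball, dist_eq_norm] using this
  obtain ⟨t, ht0, ht⟩ := mem_nhdsGE_iff_exists_Icc_subset.mp hev
  have ht0' : (0 : ℝ) < t := ht0
  set κ := ∫ s in (0 : ℝ)..t, (t - s) ^ (α - 1)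
  have hκ : 0 < κ := intervalIntegral.intervalIntegral_pos_of_pos_on (hk t)
    (fun s hs => Real.rpow_pos_of_pos (sub_pos.mpr hs.2) _) ht0'
  have hsub : ∫ s in (0 : ℝ)..t, (t - s) ^ (α - 1) • (φ w - φ (T s w)) = κ • φ w := by
    simp only [smul_sub]
    rw [intervalIntegral.integral_sub, hzero t ht0', sub_zero,
      intervalIntegral.integral_smul_const]
    · exact (hk t).smul_continuousOn continuousOn_const
    · refine (hk t).smul_continuousOn (φ.continuous.comp_continuousOn (hcont.mono ?_))
      rw [uIcc_of_le ht0'.le]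
      exact Icc_subset_Ici_self
  have hle : ‖κ • φ w‖ ≤ ∫ s in (0 : ℝ)..t, (t - s) ^ (α - 1) * ε := by
    rw [← hsub]
    refine intervalIntegral.norm_integral_le_of_norm_le ht0'.le
      (Eventually.of_forall fun s hs => ?_) ((hk t).mul_const ε)
    have hs' := ht ⟨hs.1.le, hs.2⟩
    have hp : 0 ≤ (t - s) ^ (α - 1) := Real.rpow_nonneg (sub_nonneg.mpr hs.2) _
    rw [norm_smul, Real.norm_of_nonneg hp, norm_sub_rev]
    exact mul_le_mul_of_nonneg_left (le_of_lt hs') hp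
  rw [intervalIntegral.integral_mul_const, norm_smul, Real.norm_of_nonneg hκ.le] at hle
  exact le_of_mul_le_mul_left hle hκ

/-- The operators `S r` for small `r` have no common annihilating functional. -/
lemma functional_eq_zero_of_resolventOperator [CompleteSpace E] (hα : 0 < α)
    (hT : IsSolutionOperator α A T) (hS : IsResolventOperator α A S) {φ : E →L[ℂ] ℂ} {δ : ℝ}
    (hδ : 0 < δ) (h : ∀ r ∈ Ioo 0 δ, ∀ x, φ (S r x) = 0) : φ = 0 := by
  obtain ⟨ω, hω, hlap⟩ := hS.laplace
  have hlap' : ∀ ξ : ℝ, ∃ R : E →L[ℂ] E, ω < ξ → IsResolventAt A ((ξ : ℂ) ^ (α : ℂ)) R ∧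
      ∀ u : E, IntegrableOn (fun t : ℝ => Complex.exp (-((ξ : ℂ) * t)) • S t u) (Ioi 0) ∧
        R u = ∫ t in Ioi (0 : ℝ), Complex.exp (-((ξ : ℂ) * t)) • S t u := by
    intro ξ
    by_cases hξ : ω < ξ
    · obtain ⟨R, hR⟩ := hlap (ξ : ℂ) (by simpa using hξ)
      exact ⟨R, fun _ => hR⟩
    · exact ⟨0, fun h => absurd h hξ⟩
  choose R hR using hlap'
  have hdecay := exists_norm_resolvent_le (R := R) h fun ξ hξ => (hR ξ hξ).2
  -- On the domain `x = ξ^α R x - R (A x)`, and under `φ` both terms tend to `0` as `ξ → ∞`.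
  have hdom : ∀ x ∈ A.domain, φ x = 0 := by
    intro x hx
    obtain ⟨C₁, hC₁⟩ := hdecay x
    obtain ⟨C₂, hC₂⟩ := hdecay (pmapVal A x)
    have hlim : Tendsto (fun ξ : ℝ => C₁ * (ξ ^ α * Real.exp (-δ * ξ)) +
        C₂ * (ξ ^ (0 : ℝ) * Real.exp (-δ * ξ))) atTop (𝓝 0) := by
      have := ((tendsto_rpow_mul_exp_neg_mul_atTop_nhds_zero α δ hδ).const_mul C₁).add
        ((tendsto_rpow_mul_exp_neg_mul_atTop_nhds_zero 0 δ hδ).const_mul C₂)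
      simpa using this
    refine norm_le_zero_iff.mp (ge_of_tendsto hlim ?_)
    filter_upwards [eventually_ge_atTop (ω + 1)] with ξ hξ
    have hξω : ω < ξ := by linarith
    have hξ0 : 0 < ξ := by linarith
    have h1 := (hR ξ hξω).1.2 x hx
    have h2 : φ x = (ξ : ℂ) ^ (α : ℂ) * φ (R ξ x) - φ (R ξ (pmapVal A x)) := by
      conv_lhs => rw [← h1]
      rw [map_sub, map_sub, map_smul, map_smul, smul_eq_mul]
    rw [h2]
    refine (norm_sub_le _ _).trans (add_le_add ?_ ?_)
    · rw [norm_mul, Complex.norm_cpow_eq_rpow_re_of_pos hξ0, Complex.ofReal_re]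
      calc ξ ^ α * ‖φ (R ξ x)‖ ≤ ξ ^ α * (C₁ * Real.exp (-δ * ξ)) :=
            mul_le_mul_of_nonneg_left (hC₁ ξ hξ) (Real.rpow_nonneg hξ0.le _)
        _ = _ := by ring
    · rw [Real.rpow_zero, one_mul]
      exact hC₂ ξ hξ
  ext y
  obtain ⟨h1, h2⟩ := (hR (ω + 1) (lt_add_one ω)).1.1 y
  rw [← h2, map_sub, map_smul, hdom _ h1, smul_zero,
    functional_pmapVal_eq_zero hα hT hdom h1, sub_zero, zero_apply]

/-- The operator `p ↦ ∫₀ᵃ G(a, s) p(s) ds` has dense range. -/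
lemma dense_range_green [CompleteSpace E] {m : ℕ} {c : Fin m → ℂ} {τ : Fin m → ℝ} {a : ℝ}
    (hα : 0 < α) (hT : IsSolutionOperator α A T) (hS : IsResolventOperator α A S) (ha : 0 < a)
    (hτ : ∀ k, τ k ∈ Icc (0 : ℝ) a) (hc : supNorm a T * ∑ k, ‖c k‖ < 1)
    {L : L2J a E →L[ℂ] E}
    (hL : ∀ p : L2J a E, IntegrableOn (fun s => green T S c τ a s (p s)) (Icc 0 a) ∧
      L p = ∫ s in Icc (0 : ℝ) a, green T S c τ a s (p s)) : DenseRange L := by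
  obtain ⟨Q, hQ, δ, hδ, hδa, hgreen⟩ :=
    exists_green_eq_near_end (S := S) hT.strongly_continuous ha hτ hc
  have hrange : DenseRange L ↔ (L.range)ᗮ = ⊥ := by
    rw [← Submodule.topologicalClosure_eq_top_iff]
    exact (Submodule.dense_iff_topologicalClosure_eq_top (s := L.range))
  rw [hrange, Submodule.eq_bot_iff]
  intro e he
  set φ : E →L[ℂ] ℂ := innerSL ℂ e
  have hφL : ∀ p, φ (L p) = 0 := fun p =>
    Submodule.inner_left_of_mem_orthogonal (K := L.range)
      (LinearMap.mem_range_self (L : L2J a E →ₗ[ℂ] E) p) he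
  -- Testing with `p` equal to `x` on a measurable set and `0` elsewhere gives vanishing for almost
  -- every `r`; strong continuity removes the exceptional set.
  have hS' : ∀ r ∈ Ioo 0 δ, ∀ x, (φ ∘L Q) (S r x) = 0 := by
    intro r hr x
    have hmem : ∀ s, MeasurableSet s → MemLp (s.indicator fun _ => x) 2
        (volume.restrict (Icc 0 a)) := fun s hs => (memLp_const x).indicator hs
    have hind : ∀ s (hs : MeasurableSet s),
        (fun σ => green T S c τ a σ ((hmem s hs).toLp _ σ)) =ᵐ[volume.restrict (Icc 0 a)]
          s.indicator fun σ => green T S c τ a σ x := by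
      intro s hs
      filter_upwards [(hmem s hs).coeFn_toLp] with σ hσ
      rw [hσ]
      by_cases h : σ ∈ s <;> simp [h]
    have hint : Integrable (fun σ => green T S c τ a σ x) (volume.restrict (Icc 0 a)) := by
      have := (hL ((hmem univ MeasurableSet.univ).toLp _)).1
      refine Integrable.congr this ((hind univ MeasurableSet.univ).trans ?_)
      rw [indicator_univ]
    have hae : (fun σ => φ (green T S c τ a σ x)) =ᵐ[volume.restrict (Icc 0 a)] 0 := by
      refine (φ.integrable_comp hint).ae_eq_zero_of_forall_setIntegral_eq_zero fun s hs _ => ?_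
      rw [φ.integral_comp_comm hint.integrableOn, ← integral_indicator hs,
        ← integral_congr_ae (hind s hs), ← (hL _).2]
      exact hφL _
    have hsub : Ioo (a - δ) a ⊆ Icc 0 a := fun s hs => ⟨by linarith [hs.1], hs.2.le⟩
    have hae' : (fun σ => φ (Q (S (a - σ) x))) =ᵐ[volume.restrict (Ioo (a - δ) a)]
        fun _ => 0 := by
      filter_upwards [ae_restrict_of_ae_restrict_of_subset hsub hae,
        ae_restrict_mem measurableSet_Ioo] with σ hσ hσm
      rw [← hgreen σ hσm]
      exact hσ
    have hcont : ContinuousOn (fun σ => φ (Q (S (a - σ) x))) (Ioo (a - δ) a) := by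
      refine (φ ∘L Q).continuous.comp_continuousOn ((hS.strongly_continuous x).comp
        (continuous_const.sub continuous_id).continuousOn fun σ hσ => ?_)
      exact sub_pos.mpr hσ.2
    have := Measure.eqOn_open_of_ae_eq hae' isOpen_Ioo hcont continuousOn_const
      (show a - r ∈ Ioo (a - δ) a from ⟨by linarith [hr.2], by linarith [hr.1]⟩)
    simpa using this
  have h0 := functional_eq_zero_of_resolventOperator hα hT hS hδ hS'
  have h1 : φ e = 0 := by
    have h2 := congrArg (fun f : E →L[ℂ] ℂ => f (Ring.inverse Q e)) h0
    have h3 : Q (Ring.inverse Q e) = e := by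
      rw [← mul_apply_eq_comp, Ring.mul_inverse_cancel _ hQ]; rfl
    simpa [h3] using h2
  exact inner_self_eq_zero.mp h1

end DenseRange
-- Continuity of the terminal value and the fixed point argument
section Controllability

open Filter Topology

/-- Let `K t` be strongly continuous at `a` along `D`. If a bounded sequence `h` satisfies
`K t (h n) → 0` for all `t ∈ D`, then `K a (h n)` tends weakly to `0`. -/
lemma tendsto_inner_of_forall_tendsto {X E : Type*} [NormedAddCommGroup X] [InnerProductSpace ℂ X]
    [CompleteSpace X] [NormedAddCommGroup E] [InnerProductSpace ℂ E] [CompleteSpace E]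
    {K : ℝ → X →L[ℂ] E} {D : Set ℝ} {a : ℝ} (ha : a ∈ closure D)
    (hK : ∀ p, ContinuousWithinAt (fun t => K t p) D a) {h : ℕ → X} {M : ℝ}
    (hM : ∀ n, ‖h n‖ ≤ M) (hh : ∀ t ∈ D, Tendsto (fun n => K t (h n)) atTop (𝓝 0)) (e : E) :
    Tendsto (fun n => inner ℂ e (K a (h n))) atTop (𝓝 0) := by
  set Y : Submodule ℂ X :=
    Submodule.span ℂ {z | ∃ t ∈ D, ∃ e, z = ContinuousLinearMap.adjoint (K t) e}
  set l := ContinuousLinearMap.adjoint (K a) e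
  -- A vector `z` orthogonal to `Y` satisfies `K t z = 0` on `D`, hence `K a z = 0` by continuity.
  -- Boundedness of `h` then extends convergence of the pairings from `Y` to its closure.
  have hl : l ∈ Y.topologicalClosure := by
    rw [← Submodule.orthogonal_orthogonal_eq_closure, Submodule.mem_orthogonal]
    intro z hz
    have h1 : ∀ t ∈ D, K t z = 0 := by
      intro t ht
      refine inner_self_eq_zero (𝕜 := ℂ) |>.mp ?_
      rw [← ContinuousLinearMap.adjoint_inner_left]
      exact (Submodule.mem_orthogonal Y z).mp hz _
        (Submodule.subset_span ⟨t, ht, K t z, rfl⟩)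
    have h2 : K a z = 0 := by
      have : (𝓝[D] a).NeBot := mem_closure_iff_nhdsWithin_neBot.mp ha
      refine tendsto_nhds_unique (hK z) (tendsto_const_nhds.congr' ?_)
      filter_upwards [self_mem_nhdsWithin] with t ht
      exact (h1 t ht).symm
    rw [ContinuousLinearMap.adjoint_inner_right, h2, inner_zero_left]
  have hY : ∀ z ∈ Y, Tendsto (fun n => inner ℂ z (h n)) atTop (𝓝 0) := by
    intro z hz
    induction hz using Submodule.span_induction with
    | mem z hz =>
      obtain ⟨t, ht, e', rfl⟩ := hz
      simp_rw [ContinuousLinearMap.adjoint_inner_left]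
      simpa using (tendsto_const_nhds (x := e')).inner (𝕜 := ℂ) (hh t ht)
    | zero => simp
    | add z w _ _ hz hw => simpa [inner_add_left] using hz.add hw
    | smul c z _ hz => simpa [inner_smul_left] using hz.mul_const ((starRingEnd ℂ) c)
  have hM0 : 0 ≤ M := (norm_nonneg _).trans (hM 0)
  simp_rw [← ContinuousLinearMap.adjoint_inner_left]
  rw [Metric.tendsto_atTop]
  intro ε hε
  obtain ⟨z, hz, hlz⟩ := Metric.mem_closure_iff.mp hl (ε / (2 * (M + 1))) (by positivity)
  obtain ⟨N, hN⟩ := Metric.tendsto_atTop.mp (hY z hz) (ε / 2) (by positivity)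
  refine ⟨N, fun n hn => ?_⟩
  have h1 := hN n hn
  rw [dist_zero_right] at h1 ⊢
  have h2 : inner ℂ l (h n) = inner ℂ (l - z) (h n) + inner ℂ z (h n) := by
    rw [inner_sub_left, sub_add_cancel]
  have h3 : ‖inner ℂ (l - z) (h n)‖ ≤ ε / (2 * (M + 1)) * M := by
    refine (norm_inner_le_norm _ _).trans ?_
    rw [← dist_eq_norm]
    exact mul_le_mul hlz.le (hM n) (norm_nonneg _) (by positivity)
  have h4 : ε / (2 * (M + 1)) * M ≤ ε / 2 := by
    rw [div_mul_eq_mul_div, div_le_div_iff₀ (by positivity) (by positivity)]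
    nlinarith
  show ‖inner ℂ l (h n)‖ < ε
  rw [h2]
  linarith [norm_add_le (inner ℂ (l - z) (h n)) (inner ℂ z (h n))]

/-- The image of a ball under a compact operator is approximated by a finite-dimensional subspace
of the range. -/
lemma exists_finiteDimensional_approx {X E : Type*} [NormedAddCommGroup X] [NormedSpace ℂ X]
    [NormedAddCommGroup E] [InnerProductSpace ℂ E] {L : X →L[ℂ] E} (hL : IsCompactOperator L)
    (M : ℝ) {ε : ℝ} (hε : 0 < ε) :
    ∃ V : Submodule ℂ E, ∃ _ : FiniteDimensional ℂ V, V ≤ L.range ∧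
      ∀ p, ‖p‖ ≤ M → ‖L p - V.starProjection (L p)‖ ≤ ε := by
  have htb : TotallyBounded (L '' Metric.closedBall 0 M) :=
    (hL.isCompact_closure_image_closedBall M).totallyBounded.subset subset_closure
  obtain ⟨t, htL, htf, hcov⟩ := Metric.finite_approx_of_totallyBounded htb ε hε
  have hfd : FiniteDimensional ℂ (Submodule.span ℂ t) := FiniteDimensional.span_of_finite ℂ htf
  refine ⟨Submodule.span ℂ t, hfd, ?_, fun p hp => ?_⟩
  · rw [Submodule.span_le]
    intro y hy
    obtain ⟨p, -, rfl⟩ := htL hy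
    exact LinearMap.mem_range_self (L : X →ₗ[ℂ] E) p
  · obtain ⟨y, hy, hpy⟩ := mem_iUnion₂.mp (hcov ⟨p, mem_closedBall_zero_iff.mpr hp, rfl⟩)
    rw [Submodule.starProjection_minimal]
    refine (ciInf_le ⟨0, by rintro _ ⟨z, rfl⟩; exact norm_nonneg _⟩
      (⟨y, Submodule.subset_span hy⟩ : Submodule.span ℂ t)).trans ?_
    rw [← dist_eq_norm]
    exact (Metric.mem_ball.mp hpy).le

/-- Perturbing a compact operator `L` by a continuous map `ψ` with values in the image of a ball
under `L` preserves the density of its range, also on a subspace `Z` on which `L` has the same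
range. -/
lemma exists_dist_add_lt {X E : Type*} [NormedAddCommGroup X] [NormedSpace ℂ X]
    [NormedAddCommGroup E] [InnerProductSpace ℂ E] {L : X →L[ℂ] E} (hL : IsCompactOperator L)
    (hLd : DenseRange L) {Z : Submodule ℂ X} (hZ : ∀ p, ∃ q ∈ Z, L p = L q)
    {ψ : Z → E} (hψ : Continuous ψ) {M : ℝ} (hψM : ∀ μ, ∃ p, ‖p‖ ≤ M ∧ ψ μ = L p) (x : E)
    {ε : ℝ} (hε : 0 < ε) : ∃ μ : Z, dist x (L μ + ψ μ) < ε := by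
  obtain ⟨p₀, hp₀⟩ := hLd.exists_dist_lt x (half_pos hε)
  obtain ⟨q₀, hq₀, hpq⟩ := hZ p₀
  obtain ⟨V, hVfd, hVL, hV⟩ := exists_finiteDimensional_approx hL M (ε := ε / 4) (by positivity)
  let b := Module.finBasis ℂ V
  have hlift : ∀ i, ∃ q : Z, L q = b i := by
    intro i
    obtain ⟨p, hp⟩ := hVL (b i).2
    obtain ⟨q, hq, hpq⟩ := hZ p
    exact ⟨⟨q, hq⟩, hpq.symm.trans hp⟩
  choose q hq using hlift
  -- A linear right inverse of `L` over `V` with values in `Z`.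
  let J : V →ₗ[ℂ] Z := b.constr ℂ q
  have hJ : ∀ v, L (J v) = v := by
    have h1 : (L : X →ₗ[ℂ] E) ∘ₗ Z.subtype ∘ₗ J = V.subtype := by
      refine b.ext fun i => ?_
      simp only [LinearMap.comp_apply, J, b.constr_basis]
      exact hq i
    exact fun v => congrArg (fun g : V →ₗ[ℂ] E => g v) h1
  have hJc : Continuous J := J.continuous_of_finiteDimensional
  let μ : V → Z := fun v => ⟨q₀, hq₀⟩ + J v
  -- A fixed point `v` is minus the `V`-component of `ψ (μ v)`, so `L (μ v) + ψ (μ v)` differs from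
  -- `L q₀` only by the part of `ψ (μ v)` orthogonal to `V`.
  let Ψ : V → V := fun v => -V.orthogonalProjectionOnto (ψ (μ v))
  have hΨc : Continuous Ψ :=
    (V.orthogonalProjectionOnto.continuous.comp (hψ.comp (continuous_const.add hJc))).neg
  have hψb : ∀ μ, ‖ψ μ‖ ≤ ‖L‖ * M := by
    intro μ
    obtain ⟨p, hp, hpe⟩ := hψM μ
    rw [hpe]
    exact (L.le_opNorm p).trans (mul_le_mul_of_nonneg_left hp (norm_nonneg _))
  have hΨb : ∀ v, ‖Ψ v‖ ≤ ‖L‖ * M := fun v => by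
    rw [norm_neg]
    exact (V.norm_orthogonalProjectionOnto_apply_le _).trans (hψb _)
  have : FiniteDimensional ℝ V := FiniteDimensional.complexToReal V
  obtain ⟨v, hv⟩ := exists_fixedPoint_of_bounded hΨc hΨb
  refine ⟨μ v, ?_⟩
  obtain ⟨p, hp, hpe⟩ := hψM (μ v)
  have hv' : (v : E) = -V.starProjection (ψ (μ v)) := congrArg Subtype.val hv.symm
  have h1 : L (μ v) + ψ (μ v) = L q₀ + (ψ (μ v) - V.starProjection (ψ (μ v))) := by
    have h2 : L (μ v) = L q₀ + v := by
      show L (q₀ + J v) = _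
      rw [map_add, hJ]
    rw [h2, hv']
    abel
  have h3 := hV p hp
  rw [← hpe] at h3
  rw [h1]
  calc dist x _ ≤ dist x (L q₀) + dist (L q₀) _ := dist_triangle _ _ _
    _ < ε / 2 + ε / 2 := by
        refine add_lt_add (by rwa [← hpq]) ?_
        rw [dist_self_add_right]
        linarith
    _ = ε := add_halves ε

/-- If the solution map is continuous into `L²`, then the nonlinear part of the terminal value is
continuous, although the bounded nonlinearity `w` itself need not be. -/
lemma continuous_terminal_term {E : Type*} [NormedAddCommGroup E] [InnerProductSpace ℂ E]
    [CompleteSpace E] {a : ℝ} (ha : 0 < a) {K : ℝ → L2J a E →L[ℂ] E}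
    (hK : ∀ p, ContinuousOn (fun t => K t p) (Icc 0 a)) (hKc : IsCompactOperator (K a))
    {Z : Set (L2J a E)} {W : Z → L2J a E} (hW : Continuous W) {w : L2J a E → L2J a E} {M : ℝ}
    (hM : ∀ z, ‖w z‖ ≤ M)
    (hWK : ∀ μ : Z, W μ =ᵐ[volume.restrict (Icc 0 a)] fun t => K t (μ + w (W μ))) :
    Continuous fun μ => K a (w (W μ)) := by
  refine continuous_iff_seqContinuous.mpr fun u μ hu => ?_
  refine tendsto_of_subseq_tendsto fun ns hns => ?_
  have hu' := hu.comp hns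
  obtain ⟨φ, hφ, hφW⟩ := (tendstoInMeasure_of_tendsto_Lp
    ((hW.tendsto μ).comp hu')).exists_seq_tendsto_ae
  obtain ⟨z, -, χ, hχ, hz⟩ := (hKc.isCompact_closure_image_closedBall M).tendsto_subseq
    (x := fun n => K a (w (W (u (ns (φ n))))))
    fun n => subset_closure ⟨_, mem_closedBall_zero_iff.mpr (hM _), rfl⟩
  refine ⟨φ ∘ χ, ?_⟩
  let v : ℕ → Z := fun n => u (ns (φ (χ n)))
  have hv : Tendsto v atTop (𝓝 μ) := hu'.comp (hφ.comp hχ).tendsto_atTop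
  let h : ℕ → L2J a E := fun n => w (W (v n)) - w (W μ)
  -- By the mild solution identity, `K t (h n)` is the difference of `W · t - K t ·` at `v n` and at
  -- `μ`.
  have hae : ∀ᵐ t ∂volume.restrict (Icc 0 a), Tendsto (fun n => K t (h n)) atTop (𝓝 0) := by
    filter_upwards [hφW, hWK μ, ae_all_iff.mpr fun n => hWK (v n)] with t h1 h2 h3
    have h4 : Tendsto (fun n => W (v n) t) atTop (𝓝 (W μ t)) := h1.comp hχ.tendsto_atTop
    have h5 : Tendsto (fun n => K t (v n : L2J a E)) atTop (𝓝 (K t μ)) :=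
      ((K t).continuous.tendsto _).comp ((continuous_subtype_val.tendsto _).comp hv)
    have h6 := (h4.sub h5).sub_const (W μ t - K t μ)
    rw [sub_self] at h6
    refine h6.congr fun n => ?_
    rw [h3 n, h2, map_add, map_add, map_sub]
    abel
  let D : Set ℝ := {t | t ∈ Icc 0 a ∧ Tendsto (fun n => K t (h n)) atTop (𝓝 0)}
  -- `D` has full measure in `[0, a]`, so it meets every interval ending at `a`; `a` itself need not
  -- belong to it.
  have haD : a ∈ closure D := by
    have h1 : ∀ᵐ t ∂volume.restrict (Ioo 0 a), t ∈ D := by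
      filter_upwards [ae_restrict_of_ae_restrict_of_subset Ioo_subset_Icc_self hae,
        ae_restrict_mem measurableSet_Ioo] with t ht htm
      exact ⟨Ioo_subset_Icc_self htm, ht⟩
    rw [Metric.mem_closure_iff]
    intro ε hε
    have h2 : Ioo (max 0 (a - ε)) a ⊆ Ioo 0 a := Ioo_subset_Ioo_left (le_max_left _ _)
    have h3 := ae_restrict_of_ae_restrict_of_subset h2 h1
    have h4 : (ae (volume.restrict (Ioo (max 0 (a - ε)) a))).NeBot := by
      rw [ae_neBot, Ne, Measure.restrict_eq_zero, Real.volume_Ioo, ENNReal.ofReal_eq_zero, not_le,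
        sub_pos]
      exact max_lt ha (by linarith)
    obtain ⟨t, htD, ht⟩ := (h3.and (ae_restrict_mem measurableSet_Ioo)).exists
    refine ⟨t, htD, ?_⟩
    rw [Real.dist_eq, abs_of_pos (sub_pos.mpr ht.2)]
    linarith [le_max_right 0 (a - ε), ht.1]
  have hbound : ∀ n, ‖h n‖ ≤ M + M := fun n =>
    (norm_sub_le _ _).trans (add_le_add (hM _) (hM _))
  have hweak := tendsto_inner_of_forall_tendsto haD
    (fun p => ((hK p) a (right_mem_Icc.mpr ha.le)).mono fun t ht => ht.1) hbound
    fun t ht => ht.2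
  have hlim : Tendsto (fun n => K a (h n)) atTop (𝓝 (z - K a (w (W μ)))) := by
    simp only [h, map_sub]
    exact Tendsto.sub_const hz _
  -- The norm limit supplied by compactness must agree with the weak limit `0`.
  have hz0 : z - K a (w (W μ)) = 0 := by
    refine inner_self_eq_zero (𝕜 := ℂ) |>.mp ?_
    exact tendsto_nhds_unique ((tendsto_const_nhds (x := z - K a (w (W μ)))).inner hlim)
      (hweak _)
  rw [sub_eq_zero] at hz0
  rw [← hz0]
  exact hz

end Controllability

end FracControl

theorem theorem5p1 {E U : Type*}
    [NormedAddCommGroup E] [InnerProductSpace ℂ E] [CompleteSpace E]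
    [NormedAddCommGroup U] [InnerProductSpace ℂ U] [CompleteSpace U]
    (α : ℝ) (hα₀ : 0 < α) (hα₁ : α < 1)
    (ω₀ θ₀ : ℝ) (hθ₀ : 0 < θ₀) (hθ₁ : θ₀ ≤ Real.pi / 2)
    (a : ℝ) (ha : 0 < a)
    (A : E →ₗ.[ℂ] E) (T S : ℝ → E →L[ℂ] E)
    (hT : FracControl.IsAnalyticSolutionOperator α ω₀ θ₀ A T)
    (hS : FracControl.IsResolventOperator α A S)
    (hTc : FracControl.IsCompactFamily T) (hSc : FracControl.IsCompactFamily S)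
    (m : ℕ) (c : Fin m → ℂ) (τ : Fin m → ℝ) (hτ : ∀ k, τ k ∈ Set.Icc (0 : ℝ) a)
    (hH1 : FracControl.supNorm a T * ∑ k, ‖c k‖ < 1)
    (f : ℝ → E → E)
    (B : FracControl.L2J a U →L[ℂ] FracControl.L2J a E)
    (hA' : FracControl.RangeCondition T S c τ a B)
    (W : closure (Set.range B) → FracControl.L2J a E)
    (hW : FracControl.IsSolutionMap T S c τ a f B W)
    (hB'_compact : FracControl.IsCompactMap W) (hB'_cont : Continuous W)
    (hC' : FracControl.NemytskiiUniformlyBounded a f) :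
    FracControl.ApproximatelyControllable T S c τ a f B := by
  obtain ⟨M, -, hM⟩ := hC'
  choose w hwf hwM using hM
  have hTcont := hT.isSolutionOperator.strongly_continuous
  -- The integrability half of the range condition is what makes `‖S‖` square integrable when `α ≤
  -- 1/2` is allowed.
  have hN := FracControl.kernelNorm_ne_top_of_green hTcont hS.strongly_continuous ha hτ hH1
    fun p => (hA' p).1
  obtain ⟨K, hK, hKc, hKcont⟩ :=
    FracControl.exists_greenCLM (T := T) (c := c) hTcont hS.strongly_continuous hSc hτ hN
  choose y hy hyW _ using hW
  -- `W μ` and `y μ` agree almost everywhere, so `w (W μ)` represents `f s (y μ s)` under the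
  -- integral.
  have hyK : ∀ μ : closure (range B), ∀ t ∈ Icc 0 a, y μ t = K t (μ + w (W μ)) := by
    intro μ t ht
    rw [((hy μ).2 t ht).2, (hK t ht.2 _).2]
    refine integral_congr_ae ?_
    filter_upwards [Lp.coeFn_add (μ : FracControl.L2J a E) (w (W μ)), hwf (W μ), hyW μ]
      with s h1 h2 h3
    rw [h1, Pi.add_apply, h2, h3]
  have hψ := FracControl.continuous_terminal_term ha hKcont (hKc a le_rfl) hB'_cont hwM
    fun μ => by
      filter_upwards [hyW μ, ae_restrict_mem measurableSet_Icc] with t h1 h2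
      rw [h1, hyK μ t h2]
  have hLd := FracControl.dense_range_green hα₀ hT.isSolutionOperator hS ha hτ hH1 (hK a le_rfl)
  have hZ : ∀ p, ∃ q ∈ B.range.topologicalClosure, K a p = K a q := by
    intro p
    obtain ⟨q, hq, hpq⟩ := (hA' p).2
    exact ⟨q, hq, by rw [(hK a le_rfl p).2, (hK a le_rfl q).2, hpq]⟩
  refine Metric.dense_iff.mpr fun x ε hε => ?_
  obtain ⟨⟨μ₀, hμ₀⟩, hμ⟩ := FracControl.exists_dist_add_lt (hKc a le_rfl) hLd hZ
    (ψ := fun μ => K a (w (W μ))) hψ (fun μ => ⟨_, hwM (W μ), rfl⟩) x (half_pos hε)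
  -- The forcing found above lies only in the closure of the range of `B`. Continuity of the
  -- terminal value `g` lets an actual control `B v` replace it.
  let g : closure (range B) → E := fun μ => K a μ + K a (w (W μ))
  have hg : Continuous g := ((K a).continuous.comp continuous_subtype_val).add hψ
  let μ : closure (range B) := ⟨μ₀, hμ₀⟩
  obtain ⟨δ, hδ, hδg⟩ := Metric.continuous_iff.mp hg μ (ε / 2) (half_pos hε)
  obtain ⟨_, ⟨v, rfl⟩, hv⟩ := Metric.mem_closure_iff.mp μ.2 δ hδ
  let η : closure (range B) := ⟨B v, subset_closure ⟨v, rfl⟩⟩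
  have hya : y η a = g η := by
    rw [hyK η a ⟨ha.le, le_rfl⟩, map_add]
  refine ⟨y η a, ?_, v, y η, hy η, rfl⟩
  have h1 : dist (g η) (g μ) < ε / 2 := hδg η ((dist_comm (B v) μ₀).trans_lt hv)
  have h2 : dist x (g μ) < ε / 2 := hμ
  rw [Metric.mem_ball, hya]
  linarith [dist_triangle_right (g η) x (g μ)]
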